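/- Identify $\mathbb R^4$ with the quaternions $\mathbb H$ and $\mathbb R^3$ with $\operatorname{Im}\mathbb H$. Let $M$ be a Riemann surface with complex structure $J:TM\to TM$, and write $*\omega:=\omega\circ J$ for 1-forms $\omega$; a 2-form $\sigma$ on $M$ is identified with the quadratic form $\sigma(X):=\sigma(X,JX)$. Let $f:M\to\mathbb H$ be a smooth conformal immersion with left and right normal vectors $N,R:M\to\mathbb H$, i.e. $N^2=-1=R^2$ and $*df=N\,df=-df\,R$. Let $L\subset M\times\mathbb H^2$ be the (right) quaternionic line bundle with fibre $L_p=\binom{f(p)}{1}\mathbb H$, and let $\delta(X)\psi=d\psi(X)\bmod L$ for sections $\psi$ of $L$. Let $S:M\to\operatorname{End}(\mathbb H^2)$ be the mean curvature sphere of $L$, i.e. the smooth map with $S^2=-I$, $SL=L$, $dS\,L\subset L$, $*\delta=\delta\circ S=S\circ\delta$ and $Q|_L=0$, where $Q=\frac14(S\,dS-*dS)$. Let $A=\frac14(S\,dS+*dS)$ be its Hopf field, let $\langle B\rangle=\frac18\operatorname{trace}_{\mathbb R}B$ for $B\in\operatorname{End}(\mathbb H^2)$, and let $(\alpha\wedge\beta)(X,Y)=\alpha(X)\beta(Y)-\alpha(Y)\beta(X)$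 for $\operatorname{End}(\mathbb H^2)$-valued 1-forms. Let $\mathcal H=\frac12\operatorname{trace}II$ be the mean curvature vector of $f$, where $II(X,Y)=(X\cdot df(Y))^\perp$ and the trace is taken with respect to the induced metric; let $K$ be the Gaussian curvature of the induced metric $f^*\langle\cdot,\cdot\rangle$, and let $K^\perp=\langle R^\perp(X,JX)\xi,N\xi\rangle$, for any unit vectors $X\in T_pM$ (in the induced metric) and $\xi\perp df(T_pM)$, be the normal curvature, where $R^\perp(X,Y)=[\nabla^\perp_X,\nabla^\perp_Y]-\nabla^\perp_{[X,Y]}$ is the curvature of the normal connection $\nabla^\perp_X\xi=(d\xi(X))^\perp$. Then the Willmore integrand $\langle A\wedge *A\rangle$ satisfies $$\langle A\wedge *A\rangle=\tfrac1{16}\,|R\,dR-*dR|^2=\tfrac14\bigl(|\mathcal H|^2-K-K^\perp\bigr)|df|^2 .$$ If $f$ takes values in $\mathbb R^3=\operatorname{Im}\mathbb H$, then it is the classical integrand $$\langle A\wedge *A\rangle=\tfrac14\bigl(|\mathcal H|^2-K\bigr)|df|^2 .$$ -/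

import Mathlib

open scoped Manifold ContDiff Quaternion

namespace Willmore

noncomputable section

/-! ### Riemann surfaces and quaternion-valued functions -/

section Basic

variable {M : Type*} [TopologicalSpace M] [ChartedSpace ℂ M]

/-- The real tangent space of the Riemann surface `M` at `p` (read in the preferred holomorphic
chart at `p`). -/
abbrev Tang (p : M) : Type := TangentSpace 𝓘(ℝ, ℂ) p

/-- The complex structure `J : T_p M → T_p M`, multiplication by `i` in a holomorphic chart. -/
def J (p : M) : Tang p →L[ℝ] Tang p :=
  (ContinuousLinearMap.mul ℝ ℂ Complex.I : ℂ →L[ℝ] ℂ)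

/-- Smooth quaternion-valued functions (real sense). -/
def SmoothFun (g : M → ℍ[ℝ]) : Prop := ContMDiff 𝓘(ℝ, ℂ) 𝓘(ℝ, ℍ[ℝ]) ∞ g

/-- The differential `dg` of a quaternion-valued function. -/
def dd (g : M → ℍ[ℝ]) (p : M) : Tang p →L[ℝ] ℍ[ℝ] := mfderiv 𝓘(ℝ, ℂ) 𝓘(ℝ, ℍ[ℝ]) g p

/-- `f : M → ℍ = ℝ⁴` is a smooth conformal immersion with left normal `N` and right normal `R`:
`N² = -1 = R²` and `*df = N df = - df R`, where `*df = df ∘ J`. -/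
structure IsConformalImmersion (f N R : M → ℍ[ℝ]) : Prop where
  smooth : SmoothFun f
  immersion : ∀ p, Function.Injective (dd f p)
  N_sq : ∀ p, N p * N p = -1
  R_sq : ∀ p, R p * R p = -1
  left : ∀ p (X : Tang p), dd f p (J p X) = N p * dd f p X
  right : ∀ p (X : Tang p), dd f p (J p X) = -(dd f p X * R p)

end Basic

/-! ### Metric geometry of a surface in `ℝ⁴ = ℍ`, computed in a chart -/

/-- The coordinate frame of `ℂ = ℝ²`. -/
def frame : Fin 2 → ℂ := ![1, Complex.I]

/-- Partial derivatives of real functions on the coordinate plane. -/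
def pd (i : Fin 2) (h : ℂ → ℝ) (z : ℂ) : ℝ := fderiv ℝ h z (frame i)

/-- Christoffel symbols `Γ^k_{ij}` of the Levi-Civita connection of the metric `g = (g_{ij})`. -/
def christoffel (g : ℂ → Matrix (Fin 2) (Fin 2) ℝ) (k i j : Fin 2) (z : ℂ) : ℝ :=
  (1 / 2) * ∑ l, (g z)⁻¹ k l *
    (pd i (fun w => g w j l) z + pd j (fun w => g w i l) z - pd l (fun w => g w i j) z)

/-- The coefficient of `∂_l` in `R(∂_i, ∂_j) ∂_k = ∇_i ∇_j ∂_k - ∇_j ∇_i ∂_k`. -/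
def riemann (g : ℂ → Matrix (Fin 2) (Fin 2) ℝ) (l k i j : Fin 2) (z : ℂ) : ℝ :=
  pd i (christoffel g l j k) z - pd j (christoffel g l i k) z
    + ∑ m, (christoffel g l i m z * christoffel g m j k z
        - christoffel g l j m z * christoffel g m i k z)

/-- Gaussian curvature `⟨R(∂₀, ∂₁) ∂₁, ∂₀⟩ / det g` of the metric `g`. -/
def gaussOfMetric (g : ℂ → Matrix (Fin 2) (Fin 2) ℝ) (z : ℂ) : ℝ :=
  (∑ l, riemann g l 1 0 1 z * g z l 0) / (g z).det

/-- The metric induced by a parametrized surface `F` (first fundamental form). -/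
def inducedMetric (F : ℂ → ℍ[ℝ]) (z : ℂ) : Matrix (Fin 2) (Fin 2) ℝ :=
  Matrix.of fun i j => inner ℝ (fderiv ℝ F z (frame i)) (fderiv ℝ F z (frame j))

/-- Orthogonal projection of `ℝ⁴` onto the normal space of the parametrized surface `F` at `z`. -/
def normalProj (F : ℂ → ℍ[ℝ]) (z : ℂ) : ℍ[ℝ] →L[ℝ] ℍ[ℝ] :=
  (LinearMap.range (fderiv ℝ F z : ℂ →ₗ[ℝ] ℍ[ℝ]))ᗮ.starProjection

/-- Second fundamental form `II(X, Y) = (X · dF(Y))^⊥`. -/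
def secondForm (F : ℂ → ℍ[ℝ]) (z X Y : ℂ) : ℍ[ℝ] :=
  normalProj F z (fderiv ℝ (fun w => fderiv ℝ F w Y) z X)

/-- Half the trace of `II` with respect to the induced metric. -/
def meanVec (F : ℂ → ℍ[ℝ]) (z : ℂ) : ℍ[ℝ] :=
  (1 / 2 : ℝ) • ∑ i, ∑ j, (inducedMetric F z)⁻¹ i j • secondForm F z (frame i) (frame j)

/-- The normal connection `∇^⊥_X ξ = (dξ(X))^⊥`. -/
def normalConn (F : ℂ → ℍ[ℝ]) (X : ℂ) (ξ : ℂ → ℍ[ℝ]) (z : ℂ) : ℍ[ℝ] :=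
  normalProj F z (fderiv ℝ ξ z X)

/-- The normal curvature tensor `R^⊥(X, Y) ξ = ∇^⊥_X ∇^⊥_Y ξ - ∇^⊥_Y ∇^⊥_X ξ` for commuting
(constant) coordinate fields `X, Y`. It is tensorial in `ξ`; the normal vector `ξ` at `z` is
extended to the normal field `w ↦ normalProj F w ξ`. -/
def normalCurvTensor (F : ℂ → ℍ[ℝ]) (z X Y : ℂ) (ξ : ℍ[ℝ]) : ℍ[ℝ] :=
  normalConn F X (normalConn F Y fun w => normalProj F w ξ) z
    - normalConn F Y (normalConn F X fun w => normalProj F w ξ) z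

section Surface

variable {M : Type*} [TopologicalSpace M] [ChartedSpace ℂ M]

/-- `f` read in the preferred chart at `p`. -/
def localRep (f : M → ℍ[ℝ]) (p : M) : ℂ → ℍ[ℝ] := fun z => f ((chartAt ℂ p).symm z)

/-- Gaussian curvature `K` of `(M, f^*⟨·,·⟩)` at `p`. -/
def gaussCurvature (f : M → ℍ[ℝ]) (p : M) : ℝ :=
  gaussOfMetric (inducedMetric (localRep f p)) (chartAt ℂ p p)

/-- Mean curvature vector `𝓗 = ½ trace II` of `f` at `p`. -/
def meanCurvatureVector (f : M → ℍ[ℝ]) (p : M) : ℍ[ℝ] :=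
  meanVec (localRep f p) (chartAt ℂ p p)

/-- `⟨R^⊥(X, JX) ξ, N ξ⟩`, which for unit vectors `X ∈ T_p M`, `ξ ∈ ⊥_p M` is the normal
curvature `K^⊥` of `f` at `p`. -/
def normalCurvature (f N : M → ℍ[ℝ]) (p : M) (X : Tang p) (ξ : ℍ[ℝ]) : ℝ :=
  inner ℝ (normalCurvTensor (localRep f p) (chartAt ℂ p p) X (J p X) ξ) (N p * ξ)

/-- `X` is a unit tangent vector for the induced metric. -/
def IsUnitTangent (f : M → ℍ[ℝ]) (p : M) (X : Tang p) : Prop := ‖dd f p X‖ = 1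

/-- `ξ` is a unit normal vector of `f` at `p`. -/
def IsUnitNormal (f : M → ℍ[ℝ]) (p : M) (ξ : ℍ[ℝ]) : Prop :=
  ‖ξ‖ = 1 ∧ ∀ Y : Tang p, inner ℝ (dd f p Y) ξ = 0

end Surface

/-! ### The mean curvature sphere and the Hopf fields -/

/-- `ℍ²`, as a right quaternionic vector space (module over `ℍᵐᵒᵖ`). -/
abbrev HH : Type := Fin 2 → ℍ[ℝ]

/-- Quaternionic linear endomorphisms of the right vector space `ℍ²`: matrices acting on columns
from the left. -/
abbrev EndHH : Type := Matrix (Fin 2) (Fin 2) ℍ[ℝ]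

/-- The real endomorphism of `ℍ² = ℝ⁸` given by `B`. -/
def realEnd (B : EndHH) : HH →ₗ[ℝ] HH where
  toFun v := B.mulVec v
  map_add' v w := Matrix.mulVec_add B v w
  map_smul' c v := Matrix.mulVec_smul B c v

/-- `⟨B⟩ = ⅛ trace_ℝ B`. -/
def avg (B : EndHH) : ℝ := (1 / 8) * LinearMap.trace ℝ HH (realEnd B)

section Sphere

variable {M : Type*} [TopologicalSpace M] [ChartedSpace ℂ M]

/-- The fibre at `p` of the line bundle `L = [f; 1] ⊂ M × ℍ²`. -/
def line (f : M → ℍ[ℝ]) (p : M) : Submodule (ℍ[ℝ])ᵐᵒᵖ HH :=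
  Submodule.span (ℍ[ℝ])ᵐᵒᵖ {![f p, 1]}

/-- Differential of an `ℍ²`-valued function. -/
def dVec (ψ : M → HH) (p : M) (X : Tang p) : HH := fun i => dd (fun q => ψ q i) p X

/-- Differential of an `End(ℍ²)`-valued function. -/
def dEnd (S : M → EndHH) (p : M) (X : Tang p) : EndHH :=
  Matrix.of fun i j => dd (fun q => S q i j) p X

/-- Smooth sections of `L`. -/
def IsSection (f : M → ℍ[ℝ]) (ψ : M → HH) : Prop :=
  (∀ i, SmoothFun fun q => ψ q i) ∧ ∀ q, ψ q ∈ line f q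

/-- The `End(ℍ²)`-valued 1-form `Q = ¼ (S dS - *dS)`. -/
def hopfQ (S : M → EndHH) (p : M) (X : Tang p) : EndHH :=
  (1 / 4 : ℝ) • (S p * dEnd S p X - dEnd S p (J p X))

/-- The `End(ℍ²)`-valued 1-form `A = ¼ (S dS + *dS)`. -/
def hopfA (S : M → EndHH) (p : M) (X : Tang p) : EndHH :=
  (1 / 4 : ℝ) • (S p * dEnd S p X + dEnd S p (J p X))

/-- `S` is the mean curvature sphere (congruence) of `L = [f; 1]`: the complex structure on
`M × ℍ²` with `SL = L`, `dS L ⊂ L`, `*δ = δ S = S δ` and `Q|_L = 0`.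
Here `δ(X) ψ = dψ(X) mod L` for sections `ψ` of `L`. -/
structure IsMeanCurvatureSphere (f : M → ℍ[ℝ]) (S : M → EndHH) : Prop where
  smooth : ∀ i j, SmoothFun fun q => S q i j
  sq : ∀ p, S p * S p = -1
  map_line : ∀ p, (fun v => (S p).mulVec v) '' (line f p : Set HH) = line f p
  d_line : ∀ p (X : Tang p), ∀ v ∈ line f p, (dEnd S p X).mulVec v ∈ line f p
  star_delta_eq_delta_S : ∀ ψ, IsSection f ψ → ∀ p (X : Tang p),
    dVec ψ p (J p X) - dVec (fun q => (S q).mulVec (ψ q)) p X ∈ line f p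
  star_delta_eq_S_delta : ∀ ψ, IsSection f ψ → ∀ p (X : Tang p),
    dVec ψ p (J p X) - (S p).mulVec (dVec ψ p X) ∈ line f p
  Q_line : ∀ p (X : Tang p), ∀ v ∈ line f p, (hopfQ S p X).mulVec v = 0

/-- `(α ∧ β)(X, Y) = α(X) β(Y) - α(Y) β(X)` for `End(ℍ²)`-valued 1-forms. -/
def wedge {p : M} (α β : Tang p → EndHH) (X Y : Tang p) : EndHH := α X * β Y - α Y * β X

/-- `*α = α ∘ J`. -/
def starForm {p : M} (α : Tang p → EndHH) : Tang p → EndHH := fun X => α (J p X)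

/-- The 2-form `⟨A ∧ *A⟩`, `A` the Hopf field of `S`, written as the quadratic form
`X ↦ ⟨A ∧ *A⟩(X, JX)`. -/
def willmoreIntegrand (S : M → EndHH) (p : M) (X : Tang p) : ℝ :=
  avg (wedge (hopfA S p) (starForm (hopfA S p)) X (J p X))

end Sphere

end

end Willmore

namespace Willmore

open Filter Topology

/-! ### Quaternionic algebra -/

section Algebra

/-! The first equality is linear algebra along `L`. The mean curvature sphere acts on `L` by `-R`
and on `ℍ²/L` by `N` (`right_eq`, `left_eq`). The condition `Q|_L = 0` expresses `R dR + *dR`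
through the entry `S₁₀` (`right_form_add`). The integrability relation between `dN`, `df` and `dR`
(`left_right_relation`) carries this over to `N`, where it says that the image of `A` lies in `L`
(`left_form_add`, `hopfA_range`). The trace of `A(X)²` therefore only sees the scalar by which
`A(X)` acts on `L`, which is `¼ (R dR - *dR)(X)` (`hopfA_base`). Both `A(X)²` and `A(JX)²`
contribute the same amount to the integrand.

The second equality is surface theory in a conformal coordinate `x + iy`. Polarization gives `|R R_x
- R_y|² = |R R_x + R_y|² - 4⟨R R_x, R_y⟩`. The form with the plus sign computes the Laplacian of
`f`, which is normal to the surface, so its square is `4|𝓗|²|f_x|²` (`norm_meanVec_sq`). The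
remaining term is the signed area density `ρ = ⟨R R_x, R_y⟩` of `R` as a map to the unit sphere of
`Im ℍ`; let `ν` be that of `N`. Then `K|f_x|² = ½(ρ + ν)` (`gaussOfMetric_eq`) and `K^⊥|f_x|² = ½(ρ
- ν)` (`normalCurvature_eq`), so `K + K^⊥` leaves exactly `ρ`. For a surface in `Im ℍ` one has `N =
R`, hence `ρ = ν` and `K` alone already gives `ρ`. -/

theorem inner_eq_components (x y : ℍ[ℝ]) :
    inner ℝ x y = x.re * y.re + x.imI * y.imI + x.imJ * y.imJ + x.imK * y.imK := by
  simp [Quaternion.inner_def]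

theorem norm_sq_eq_components (x : ℍ[ℝ]) :
    ‖x‖ ^ 2 = x.re * x.re + x.imI * x.imI + x.imJ * x.imJ + x.imK * x.imK := by
  rw [← real_inner_self_eq_norm_sq, inner_eq_components]

theorem re_mul_comm (x y : ℍ[ℝ]) : (x * y).re = (y * x).re := by
  simp only [Quaternion.re_mul]
  ring

theorem inner_mul_mul_left (a p q : ℍ[ℝ]) :
    inner ℝ (a * p) (a * q) = ‖a‖ ^ 2 * inner ℝ p q := by
  rw [norm_sq_eq_components]
  simp only [inner_eq_components, Quaternion.re_mul, Quaternion.imI_mul, Quaternion.imJ_mul,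
    Quaternion.imK_mul]
  ring

theorem inner_mul_mul_right (a p q : ℍ[ℝ]) :
    inner ℝ (p * a) (q * a) = ‖a‖ ^ 2 * inner ℝ p q := by
  rw [norm_sq_eq_components]
  simp only [inner_eq_components, Quaternion.re_mul, Quaternion.imI_mul, Quaternion.imJ_mul,
    Quaternion.imK_mul]
  ring

theorem inner_self_mul (a p : ℍ[ℝ]) : inner ℝ a (a * p) = ‖a‖ ^ 2 * p.re := by
  have h := inner_mul_mul_left a 1 p
  rw [mul_one] at h
  rw [h]
  simp [inner_eq_components]

variable {r : ℍ[ℝ]}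

theorem re_eq_zero_of_sq (hr : r * r = -1) : r.re = 0 := by
  have h0 := congrArg QuaternionAlgebra.re hr
  have h1 := congrArg QuaternionAlgebra.imI hr
  have h2 := congrArg QuaternionAlgebra.imJ hr
  have h3 := congrArg QuaternionAlgebra.imK hr
  simp only [Quaternion.re_mul, Quaternion.imI_mul, Quaternion.imJ_mul, Quaternion.imK_mul,
    Quaternion.re_neg, Quaternion.imI_neg, Quaternion.imJ_neg, Quaternion.imK_neg,
    Quaternion.re_one, Quaternion.imI_one, Quaternion.imJ_one, Quaternion.imK_one] at h0 h1 h2 h3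
  by_contra hne
  have e1 : r.imI = 0 := by
    apply (mul_eq_zero.1 (_ : r.re * r.imI = 0)).resolve_left hne; linarith
  have e2 : r.imJ = 0 := by
    apply (mul_eq_zero.1 (_ : r.re * r.imJ = 0)).resolve_left hne; linarith
  have e3 : r.imK = 0 := by
    apply (mul_eq_zero.1 (_ : r.re * r.imK = 0)).resolve_left hne; linarith
  rw [e1, e2, e3] at h0
  nlinarith [mul_self_nonneg r.re]

theorem components_sq_of_sq (hr : r * r = -1) :
    r.imI * r.imI + r.imJ * r.imJ + r.imK * r.imK = 1 := by
  have h0 := congrArg QuaternionAlgebra.re hr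
  have h1 := re_eq_zero_of_sq hr
  simp only [Quaternion.re_mul, Quaternion.re_neg, Quaternion.re_one, h1] at h0
  linarith

theorem norm_sq_of_sq (hr : r * r = -1) : ‖r‖ ^ 2 = 1 := by
  rw [norm_sq_eq_components, re_eq_zero_of_sq hr]
  linarith [components_sq_of_sq hr]

theorem norm_of_sq (hr : r * r = -1) : ‖r‖ = 1 := by
  exact (pow_eq_one_iff_of_nonneg (norm_nonneg r) two_ne_zero).1 (norm_sq_of_sq hr)

/-- Left multiplication by an imaginary quaternion is skew. -/
theorem inner_imaginary_mul (hr : r.re = 0) (x y : ℍ[ℝ]) :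
    inner ℝ (r * x) y = -inner ℝ x (r * y) := by
  simp only [inner_eq_components, Quaternion.re_mul, Quaternion.imI_mul, Quaternion.imJ_mul,
    Quaternion.imK_mul, hr]
  ring

/-- Right multiplication by an imaginary quaternion is skew. -/
theorem inner_mul_imaginary (hr : r.re = 0) (x y : ℍ[ℝ]) :
    inner ℝ (x * r) y = -inner ℝ x (y * r) := by
  simp only [inner_eq_components, Quaternion.re_mul, Quaternion.imI_mul, Quaternion.imJ_mul,
    Quaternion.imK_mul, hr]
  ring

/-- The map `p ↦ r p r` is a reflection: `-1` on the plane spanned by `1` and `r`, `+1` on its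
orthogonal complement. -/
theorem inner_conj_imaginary (hr : r * r = -1) (p q : ℍ[ℝ]) :
    inner ℝ (r * p * r) q
      = inner ℝ p q - 2 * (p.re * q.re) - 2 * (inner ℝ p r * inner ℝ q r) := by
  have h1 := components_sq_of_sq hr
  have h0 := re_eq_zero_of_sq hr
  simp only [inner_eq_components, Quaternion.re_mul, Quaternion.imI_mul, Quaternion.imJ_mul,
    Quaternion.imK_mul, h0]
  linear_combination
    (-p.re * q.re + p.imI * q.imI + p.imJ * q.imJ + p.imK * q.imK) * h1

theorem re_eq_zero_of_anticomm {s : ℍ[ℝ]} (hr : r * r = -1) (hs : r * s + s * r = 0) :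
    s.re = 0 := by
  have h : r * s * r = s := by
    linear_combination (norm := noncomm_ring) hs * r - s * hr
  have h2 := congrArg QuaternionAlgebra.re h
  have h3 : r * r * s = -s := by rw [hr, neg_one_mul]
  have h4 := re_mul_comm (r * s) r
  rw [← mul_assoc, h3, h, Quaternion.re_neg] at h4
  linarith

theorem inner_eq_zero_of_anticomm {s : ℍ[ℝ]} (hr : r * r = -1) (hs : r * s + s * r = 0) :
    inner ℝ s r = 0 := by
  have h := congrArg QuaternionAlgebra.re hs
  have h0 := re_eq_zero_of_sq hr
  simp only [Quaternion.re_mul, Quaternion.re_add, Quaternion.re_zero, h0] at h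
  rw [inner_eq_components, h0]
  linarith

theorem anticomm_of_inner_eq_zero {q : ℍ[ℝ]} (hr : r * r = -1) (hq : q.re = 0)
    (h : inner ℝ q r = 0) : q * r = -(r * q) := by
  have h0 := re_eq_zero_of_sq hr
  rw [inner_eq_components, h0] at h
  ext <;> simp only [Quaternion.re_mul, Quaternion.imI_mul, Quaternion.imJ_mul,
    Quaternion.imK_mul, Quaternion.re_neg, Quaternion.imI_neg, Quaternion.imJ_neg,
    Quaternion.imK_neg, h0, hq] <;> linarith

/-- The commutator of two vectors orthogonal to the unit imaginary `r` is a multiple of `r`. -/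
theorem commutator_eq_smul {s t : ℍ[ℝ]} (hr : r * r = -1) (hs : r * s + s * r = 0)
    (ht : r * t + t * r = 0) :
    s * t - t * s = (2 * inner ℝ (r * s) t) • r := by
  have h0 := re_eq_zero_of_sq hr
  have h1 := components_sq_of_sq hr
  have hs0 := re_eq_zero_of_anticomm hr hs
  have ht0 := re_eq_zero_of_anticomm hr ht
  have hsr := inner_eq_zero_of_anticomm hr hs
  have htr := inner_eq_zero_of_anticomm hr ht
  simp only [inner_eq_components, h0, hs0, ht0] at hsr htr
  ext <;> simp only [inner_eq_components, Quaternion.re_mul, Quaternion.imI_mul,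
    Quaternion.imJ_mul, Quaternion.imK_mul, Quaternion.re_sub, Quaternion.imI_sub,
    Quaternion.imJ_sub, Quaternion.imK_sub, Quaternion.re_smul, Quaternion.imI_smul,
    Quaternion.imJ_smul, Quaternion.imK_smul, smul_eq_mul, h0, hs0, ht0]
  · ring
  -- In `ℝ³`, `det(r,s,t) r = |r|² s×t + ⟨s,r⟩ t×r + ⟨t,r⟩ r×s`; the three components of this
  -- identity supply the coefficients here and below.
  · linear_combination (-2 * (s.imJ * t.imK - s.imK * t.imJ)) * h1
      + 2 * (r.imJ * t.imK - r.imK * t.imJ) * hsr - 2 * (r.imJ * s.imK - r.imK * s.imJ) * htr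
  · linear_combination (-2 * (s.imK * t.imI - s.imI * t.imK)) * h1
      + 2 * (r.imK * t.imI - r.imI * t.imK) * hsr - 2 * (r.imK * s.imI - r.imI * s.imK) * htr
  · linear_combination (-2 * (s.imI * t.imJ - s.imJ * t.imI)) * h1
      + 2 * (r.imI * t.imJ - r.imJ * t.imI) * hsr - 2 * (r.imI * s.imJ - r.imJ * s.imI) * htr

theorem norm_sub_sq_eq_norm_add_sq {s t : ℍ[ℝ]} :
    ‖s - t‖ ^ 2 = ‖s + t‖ ^ 2 - 4 * inner ℝ s t := by
  rw [norm_sub_sq_real, norm_add_sq_real]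
  ring

/-- The algebraic form of the Gauss equation: `α`, `s`, `t` stand for `a⁻¹ a_x`, `r_x`, `r_y`. -/
theorem gauss_algebra {α s t : ℍ[ℝ]} (hr : r * r = -1) (hs : r * s + s * r = 0)
    (ht : r * t + t * r = 0) :
    inner ℝ α (-α - r * s - t) - ‖α * r + s‖ ^ 2 + 2 * α.re ^ 2 + 2 * (inner ℝ α r) ^ 2
      = (1 / 2) * (inner ℝ (r * s) t
        - inner ℝ (α + r * α * r + r * s) (α + r * α * r + 2 * (r * s) + t)) := by
  have ht0 := re_eq_zero_of_anticomm hr ht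
  have htr := inner_eq_zero_of_anticomm hr ht
  have hrs : r * (r * s) + (r * s) * r = 0 := by
    linear_combination (norm := noncomm_ring) r * hs
  have hrs0 := re_eq_zero_of_anticomm hr hrs
  have hrsr := inner_eq_zero_of_anticomm hr hrs
  have hr0 := re_eq_zero_of_sq hr
  have hk : ∀ q : ℍ[ℝ], inner ℝ (r * α * r) q
      = inner ℝ α q - 2 * (α.re * q.re) - 2 * (inner ℝ α r * inner ℝ q r) :=
    inner_conj_imaginary hr α
  have hkre : (r * α * r).re = -α.re := by
    have h := re_mul_comm (r * α) r
    rw [← mul_assoc, hr, neg_one_mul] at h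
    simpa using h
  have hrr : inner ℝ r r = 1 := by rw [real_inner_self_eq_norm_sq, norm_sq_of_sq hr]
  have har : inner ℝ (α * r) s = inner ℝ α (r * s) := by
    rw [inner_mul_imaginary hr0, ← inner_neg_right]
    congr 1
    linear_combination (norm := noncomm_ring) -hs
  have hnorm : inner ℝ (α * r) (α * r) = inner ℝ α α := by
    rw [inner_mul_mul_right, norm_sq_of_sq hr, one_mul]
  have hnorm' : inner ℝ (r * s) (r * s) = inner ℝ s s := by
    rw [inner_mul_mul_left, norm_sq_of_sq hr, one_mul]
  have two : (2 : ℍ[ℝ]) * (r * s) = r * s + r * s := two_mul _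
  rw [two, ← real_inner_self_eq_norm_sq]
  simp only [inner_add_left, inner_add_right, inner_sub_right, inner_neg_right, hnorm, har,
    real_inner_comm (α * r) s, real_inner_comm (r * α * r) (r * s),
    hnorm', real_inner_comm α (r * s)]
  simp only [hk, hkre, ht0, htr, hrs0, hrsr, hr0, hrr, real_inner_comm (r * α * r) α]
  ring

end Algebra

/-! ### Calculus on the coordinate plane -/

section Calculus

theorem fderiv_mul_quaternion {x y : ℂ → ℍ[ℝ]} {z : ℂ} (hx : DifferentiableAt ℝ x z)
    (hy : DifferentiableAt ℝ y z) (v : ℂ) :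
    fderiv ℝ (fun w => x w * y w) z v = fderiv ℝ x z v * y z + x z * fderiv ℝ y z v := by
  have h := (hx.hasFDerivAt.mul' hy.hasFDerivAt).fderiv
  have h2 := congrArg (fun T : ℂ →L[ℝ] ℍ[ℝ] => T v) h
  refine h2.trans ?_
  simp [add_comm]

theorem contDiffAt_fderiv_apply {V : Type*} [NormedAddCommGroup V] [NormedSpace ℝ V]
    {G : ℂ → V} {z : ℂ} {m n : ℕ∞ω} (hG : ContDiffAt ℝ n G z) (hmn : m + 1 ≤ n) (v : ℂ) :
    ContDiffAt ℝ m (fun w => fderiv ℝ G w v) z :=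
  (hG.fderiv_right hmn).clm_apply contDiffAt_const

theorem fderiv_fderiv_comm {V : Type*} [NormedAddCommGroup V] [NormedSpace ℝ V]
    {G : ℂ → V} {z : ℂ} (hG : ContDiffAt ℝ 2 G z) (u v : ℂ) :
    fderiv ℝ (fun w => fderiv ℝ G w v) z u = fderiv ℝ (fun w => fderiv ℝ G w u) z v := by
  have hd : DifferentiableAt ℝ (fderiv ℝ G) z :=
    (hG.fderiv_right (m := 1) (by norm_num)).differentiableAt (by norm_num)
  have key : ∀ x : ℂ, fderiv ℝ (fun w => fderiv ℝ G w x) z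
      = (fderiv ℝ (fderiv ℝ G) z).flip x := by
    intro x
    rw [fderiv_clm_apply hd (differentiableAt_const x)]
    simp
  rw [key, key]
  exact hG.isSymmSndFDerivAt (by simp) u v

theorem fderiv_eq_re_im {V : Type*} [NormedAddCommGroup V] [NormedSpace ℝ V]
    (T : ℂ →L[ℝ] V) (v : ℂ) : T v = v.re • T 1 + v.im • T Complex.I := by
  rw [← map_smul, ← map_smul, ← map_add]
  congr 1
  simp [Complex.re_add_im]

/-- Differentiating `x² = -1`. -/
theorem fderiv_anticomm {x : ℂ → ℍ[ℝ]} {z : ℂ} (hx : DifferentiableAt ℝ x z)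
    (h : ∀ᶠ w in 𝓝 z, x w * x w = -1) (v : ℂ) :
    x z * fderiv ℝ x z v + fderiv ℝ x z v * x z = 0 := by
  have h1 : (fun w => x w * x w) =ᶠ[𝓝 z] fun _ => -1 := h
  have h2 := congrArg (fun T : ℂ →L[ℝ] ℍ[ℝ] => T v) h1.fderiv_eq
  simp only [fderiv_mul_quaternion hx hx, fderiv_fun_const, Pi.zero_apply,
    zero_apply] at h2
  rw [add_comm]
  exact h2

end Calculus

/-! ### Gaussian curvature of a conformally flat metric -/

section ConformalMetric

variable {g : ℂ → Matrix (Fin 2) (Fin 2) ℝ} {E : ℂ → ℝ} {z : ℂ}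

theorem pd_congr {h k : ℂ → ℝ} (hk : h =ᶠ[𝓝 z] k) (i : Fin 2) : pd i h z = pd i k z := by
  rw [pd, pd, hk.fderiv_eq]

theorem pd_metric (hg : g =ᶠ[𝓝 z] fun w => E w • (1 : Matrix (Fin 2) (Fin 2) ℝ))
    (i j l : Fin 2) : pd i (fun w => g w j l) z = if j = l then pd i E z else 0 := by
  have h : (fun w => g w j l) =ᶠ[𝓝 z] fun w => if j = l then E w else 0 := by
    filter_upwards [hg] with w hw
    rw [hw]
    simp [Matrix.one_apply]
  rw [pd_congr h]
  split_ifs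
  · rfl
  · simp [pd]

theorem inv_smul_one_matrix (c : ℝ) :
    (c • (1 : Matrix (Fin 2) (Fin 2) ℝ))⁻¹ = c⁻¹ • (1 : Matrix (Fin 2) (Fin 2) ℝ) := by
  by_cases hc : c = 0
  · simp [hc]
  · apply Matrix.inv_eq_left_inv
    simp [smul_smul, hc]

theorem christoffel_conformal (hg : g =ᶠ[𝓝 z] fun w => E w • (1 : Matrix (Fin 2) (Fin 2) ℝ))
    (k i j : Fin 2) :
    christoffel g k i j z = (1 / 2) * ((E z)⁻¹ * ((if j = k then pd i E z else 0)
      + (if i = k then pd j E z else 0) - (if i = j then pd k E z else 0))) := by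
  rw [christoffel]
  simp only [pd_metric hg, hg.eq_of_nhds, inv_smul_one_matrix]
  congr 1
  rw [Finset.sum_eq_single k]
  · simp
  · intro l _ hl
    simp [Ne.symm hl]
  · simp

theorem pd_inv_mul {h : ℂ → ℝ} (hE : DifferentiableAt ℝ E z) (hE0 : E z ≠ 0)
    (hh : DifferentiableAt ℝ h z) (i : Fin 2) :
    pd i (fun w => (1 / 2) * ((E w)⁻¹ * h w)) z
      = (1 / 2) * (pd i h z / E z - pd i E z * h z / E z ^ 2) := by
  have h1 := (((hasDerivAt_inv hE0).comp_hasFDerivAt z hE.hasFDerivAt).mul hh.hasFDerivAt).const_mul (1 / 2 : ℝ)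
  have h2 := congrArg (fun T : ℂ →L[ℝ] ℝ => T (frame i)) h1.fderiv
  rw [pd]
  refine h2.trans ?_
  simp [pd]
  field_simp
  ring

/-- This is `K = -Δ log E / (2E)` with the logarithm expanded. The metric has the form `E · 1` on a
neighbourhood, so the Christoffel symbols are explicit there and can be differentiated; diagonality
leaves only `Γ⁰₁₁` and `Γ⁰₀₁` to differentiate. -/
theorem gaussOfMetric_conformal
    (hg : g =ᶠ[𝓝 z] fun w => E w • (1 : Matrix (Fin 2) (Fin 2) ℝ))
    (hE : ContDiffAt ℝ 2 E z) (hE0 : E z ≠ 0) :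
    gaussOfMetric g z = -(1 / (2 * E z)) * ((pd 0 (pd 0 E) z + pd 1 (pd 1 E) z) / E z
      - (pd 0 E z ^ 2 + pd 1 E z ^ 2) / E z ^ 2) := by
  have hEd : DifferentiableAt ℝ E z := hE.differentiableAt (by norm_num)
  have hp : ∀ i, DifferentiableAt ℝ (pd i E) z := fun i =>
    (contDiffAt_fderiv_apply hE (m := 1) (by norm_num) (frame i)).differentiableAt (by norm_num)
  have hc : ∀ k i j, christoffel g k i j =ᶠ[𝓝 z] fun w => (1 / 2) * ((E w)⁻¹ *
      ((if j = k then pd i E w else 0)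
      + (if i = k then pd j E w else 0) - (if i = j then pd k E w else 0))) := by
    intro k i j
    filter_upwards [hg.eventuallyEq_nhds] with w hw
    exact christoffel_conformal hw k i j
  have e1 : pd 0 (christoffel g 0 1 1) z
      = (1 / 2) * (-pd 0 (pd 0 E) z / E z + pd 0 E z * pd 0 E z / E z ^ 2) := by
    rw [pd_congr (k := fun w => (1 / 2) * ((E w)⁻¹ * (-pd 0 E w)))
      (by filter_upwards [hc 0 1 1] with w hw; rw [hw]; simp), pd_inv_mul hEd hE0 (hp 0).fun_neg]
    have hneg : pd 0 (fun w => -pd 0 E w) z = -pd 0 (pd 0 E) z := by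
      rw [pd, fderiv_fun_neg]
      rfl
    rw [hneg]
    ring
  have e2 : pd 1 (christoffel g 0 0 1) z
      = (1 / 2) * (pd 1 (pd 1 E) z / E z - pd 1 E z * pd 1 E z / E z ^ 2) := by
    rw [pd_congr (k := fun w => (1 / 2) * ((E w)⁻¹ * (pd 1 E w)))
      (by filter_upwards [hc 0 0 1] with w hw; rw [hw]; simp), pd_inv_mul hEd hE0 (hp 1)]
  have hdet : (g z).det = E z ^ 2 := by
    rw [hg.eq_of_nhds]
    simp
  rw [gaussOfMetric, hdet, Fin.sum_univ_two]
  have g0 : g z 0 0 = E z := by rw [hg.eq_of_nhds]; simp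
  have g1 : g z 1 0 = 0 := by rw [hg.eq_of_nhds]; simp
  rw [g0, g1, riemann, e1, e2]
  simp only [Fin.sum_univ_two, fun k i j => (hc k i j).eq_of_nhds]
  simp only [if_true, zero_ne_one, one_ne_zero, if_false]
  field_simp
  ring

end ConformalMetric

/-! ### Conformal parametrizations -/

/-- `F` is near `z` a conformal parametrization of a surface in `ℍ`, with left and right normals
`n` and `r`. -/
structure IsConformalParam (F n r : ℂ → ℍ[ℝ]) (z : ℂ) : Prop where
  smooth : ContDiffAt ℝ 3 F z
  smooth_left : ContDiffAt ℝ 2 n z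
  smooth_right : ContDiffAt ℝ 2 r z
  left_sq : ∀ᶠ w in 𝓝 z, n w * n w = -1
  right_sq : ∀ᶠ w in 𝓝 z, r w * r w = -1
  left : ∀ᶠ w in 𝓝 z, ∀ v, fderiv ℝ F w (Complex.I * v) = n w * fderiv ℝ F w v
  right : ∀ᶠ w in 𝓝 z, ∀ v, fderiv ℝ F w (Complex.I * v) = -(fderiv ℝ F w v * r w)
  ne_zero : fderiv ℝ F z 1 ≠ 0

namespace IsConformalParam

variable {F n r : ℂ → ℍ[ℝ]} {z : ℂ}

/-- All conditions are open, so each pointwise identity derived from them holds near `z` and may be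
differentiated again. -/
theorem eventually (h : IsConformalParam F n r z) : ∀ᶠ w in 𝓝 z, IsConformalParam F n r w := by
  have hne : ∀ᶠ w in 𝓝 z, fderiv ℝ F w 1 ≠ 0 :=
    (contDiffAt_fderiv_apply h.smooth (m := 2) (by norm_num) 1).continuousAt.eventually_ne
      h.ne_zero
  filter_upwards [h.smooth.eventually (by simp), h.smooth_left.eventually (by simp),
    h.smooth_right.eventually (by simp), h.left_sq.eventually_nhds,
    h.right_sq.eventually_nhds, h.left.eventually_nhds, h.right.eventually_nhds, hne]
    with w h1 h2 h3 h4 h5 h6 h7 h8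
  exact ⟨h1, h2, h3, h4, h5, h6, h7, h8⟩

theorem diff_left (h : IsConformalParam F n r z) : DifferentiableAt ℝ n z :=
  h.smooth_left.differentiableAt (by norm_num)

theorem diff_right (h : IsConformalParam F n r z) : DifferentiableAt ℝ r z :=
  h.smooth_right.differentiableAt (by norm_num)

theorem smooth_partial (h : IsConformalParam F n r z) (v : ℂ) :
    ContDiffAt ℝ 2 (fun w => fderiv ℝ F w v) z :=
  contDiffAt_fderiv_apply h.smooth (by norm_num) v

theorem diff_partial (h : IsConformalParam F n r z) (v : ℂ) :
    DifferentiableAt ℝ (fun w => fderiv ℝ F w v) z :=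
  (h.smooth_partial v).differentiableAt (by norm_num)

theorem left_anticomm (h : IsConformalParam F n r z) (v : ℂ) :
    n z * fderiv ℝ n z v + fderiv ℝ n z v * n z = 0 :=
  fderiv_anticomm h.diff_left h.left_sq v

theorem right_anticomm (h : IsConformalParam F n r z) (v : ℂ) :
    r z * fderiv ℝ r z v + fderiv ℝ r z v * r z = 0 :=
  fderiv_anticomm h.diff_right h.right_sq v

theorem mul_eq_neg_mul (h : IsConformalParam F n r z) (v : ℂ) :
    n z * fderiv ℝ F z v = -(fderiv ℝ F z v * r z) := by
  rw [← h.left.self_of_nhds, h.right.self_of_nhds]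

theorem apply_I_left (h : IsConformalParam F n r z) :
    fderiv ℝ F z Complex.I = n z * fderiv ℝ F z 1 := by
  simpa using h.left.self_of_nhds 1

theorem apply_I_right (h : IsConformalParam F n r z) :
    fderiv ℝ F z Complex.I = -(fderiv ℝ F z 1 * r z) := by
  simpa using h.right.self_of_nhds 1

theorem snd_left (h : IsConformalParam F n r z) (v : ℂ) :
    fderiv ℝ (fun w => fderiv ℝ F w Complex.I) z v
      = fderiv ℝ n z v * fderiv ℝ F z 1 + n z * fderiv ℝ (fun w => fderiv ℝ F w 1) z v := by
  have e : (fun w => fderiv ℝ F w Complex.I) =ᶠ[𝓝 z] fun w => n w * fderiv ℝ F w 1 := by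
    filter_upwards [h.eventually] with w hw
    exact hw.apply_I_left
  rw [e.fderiv_eq, fderiv_mul_quaternion h.diff_left (h.diff_partial 1)]

theorem snd_right (h : IsConformalParam F n r z) (v : ℂ) :
    fderiv ℝ (fun w => fderiv ℝ F w Complex.I) z v
      = -(fderiv ℝ (fun w => fderiv ℝ F w 1) z v * r z + fderiv ℝ F z 1 * fderiv ℝ r z v) := by
  have e : (fun w => fderiv ℝ F w Complex.I) =ᶠ[𝓝 z] fun w => -(fderiv ℝ F w 1 * r w) := by
    filter_upwards [h.eventually] with w hw
    exact hw.apply_I_right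
  rw [e.fderiv_eq, fderiv_fun_neg, ← fderiv_mul_quaternion (h.diff_partial 1) h.diff_right]
  rfl

theorem snd_comm (h : IsConformalParam F n r z) (u v : ℂ) :
    fderiv ℝ (fun w => fderiv ℝ F w v) z u = fderiv ℝ (fun w => fderiv ℝ F w u) z v :=
  fderiv_fderiv_comm (h.smooth.of_le (by norm_num)) u v

/-- The relation `dn ∧ dF = dF ∧ dr`, evaluated on the coordinate frame. -/
theorem left_right_relation (h : IsConformalParam F n r z) :
    (n z * fderiv ℝ n z 1 + fderiv ℝ n z Complex.I) * fderiv ℝ F z 1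
      = -(fderiv ℝ F z 1 * (r z * fderiv ℝ r z 1 + fderiv ℝ r z Complex.I)) := by
  have h1 := h.snd_left Complex.I
  have h2 := h.snd_right Complex.I
  have h3 := h.snd_left 1
  have h4 := h.snd_right 1
  rw [h.snd_comm Complex.I 1] at h1 h2
  have hn := h.left_sq.self_of_nhds
  have hr := h.right_sq.self_of_nhds
  have ha := h.right_anticomm 1
  generalize fderiv ℝ (fun w => fderiv ℝ F w Complex.I) z Complex.I = byy at *
  generalize fderiv ℝ (fun w => fderiv ℝ F w Complex.I) z 1 = bx at *
  generalize fderiv ℝ (fun w => fderiv ℝ F w 1) z 1 = ax at *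
  linear_combination (norm := noncomm_ring) h2 - h1 - n z * h3 - h4 * r z
    - hn * ax + ax * hr + fderiv ℝ F z 1 * ha

/-- The Laplacian of a conformal parametrization. -/
theorem laplacian_eq (h : IsConformalParam F n r z) :
    fderiv ℝ (fun w => fderiv ℝ F w 1) z 1
        + fderiv ℝ (fun w => fderiv ℝ F w Complex.I) z Complex.I
      = -(fderiv ℝ F z 1 * (r z * fderiv ℝ r z 1 + fderiv ℝ r z Complex.I)) := by
  have h2 := h.snd_right Complex.I
  have h4 := h.snd_right 1
  rw [h.snd_comm Complex.I 1] at h2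
  have hr := h.right_sq.self_of_nhds
  have ha := h.right_anticomm 1
  linear_combination (norm := noncomm_ring) h2 - h4 * r z
    + fderiv ℝ (fun w => fderiv ℝ F w 1) z 1 * hr + fderiv ℝ F z 1 * ha

/-! #### The normal projection -/

theorem mem_orthogonal_iff (y : ℍ[ℝ]) :
    y ∈ (LinearMap.range (fderiv ℝ F z : ℂ →ₗ[ℝ] ℍ[ℝ]))ᗮ ↔
      ∀ v, inner ℝ (fderiv ℝ F z v) y = 0 := by
  rw [Submodule.mem_orthogonal]
  constructor
  · exact fun h v => h _ ⟨v, rfl⟩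
  · rintro h _ ⟨v, rfl⟩
    exact h v

/-- Normal vectors satisfy `n y = y r`. -/
theorem left_mul_normal (h : IsConformalParam F n r z) {y : ℍ[ℝ]}
    (hy : ∀ v, inner ℝ (fderiv ℝ F z v) y = 0) : n z * y = y * r z := by
  have ha := h.ne_zero
  have h1 := hy 1
  have h2 := hy Complex.I
  have hr := h.right_sq.self_of_nhds
  have hna := h.mul_eq_neg_mul 1
  rw [h.apply_I_right] at h2
  set a := fderiv ℝ F z 1
  -- Write `y = a q`. Orthogonality to the tangent vectors `a` and `-a r` says that `q` is imaginary
  -- and orthogonal to `r`, hence anticommutes with `r`.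
  have hq : a * (a⁻¹ * y) = y := mul_inv_cancel_left₀ ha y
  have hna2 : ‖a‖ ^ 2 ≠ 0 := pow_ne_zero 2 (norm_ne_zero_iff.2 ha)
  generalize a⁻¹ * y = q at hq
  subst hq
  rw [inner_self_mul] at h1
  rw [inner_neg_left, inner_mul_mul_left, neg_eq_zero] at h2
  have hq0 := (mul_eq_zero.1 h1).resolve_left hna2
  have hqr := (mul_eq_zero.1 h2).resolve_left hna2
  rw [real_inner_comm] at hqr
  have hc := anticomm_of_inner_eq_zero hr hq0 hqr
  linear_combination (norm := noncomm_ring) hna * q - a * hc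

/-- The map `v ↦ n v r` is symmetric, equal to `+1` on tangent vectors and `-1` on normal vectors,
because `n v = -v r` on the former and `n v = v r` on the latter. -/
theorem normalProj_eq (h : IsConformalParam F n r z) (v : ℍ[ℝ]) :
    normalProj F z v = (1 / 2 : ℝ) • (v - n z * v * r z) := by
  have hr := h.right_sq.self_of_nhds
  have hn := h.left_sq.self_of_nhds
  have hr0 := re_eq_zero_of_sq hr
  have hn0 := re_eq_zero_of_sq hn
  have skew : ∀ x y : ℍ[ℝ], inner ℝ (n z * x * r z) y = inner ℝ x (n z * y * r z) := by
    intro x y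
    rw [inner_mul_imaginary hr0, inner_imaginary_mul hn0, neg_neg, mul_assoc]
  apply Submodule.eq_starProjection_of_mem_of_inner_eq_zero
  · rw [mem_orthogonal_iff]
    intro u
    have e : n z * fderiv ℝ F z u * r z = fderiv ℝ F z u := by
      linear_combination (norm := noncomm_ring) h.mul_eq_neg_mul u * r z - fderiv ℝ F z u * hr
    rw [inner_smul_right, inner_sub_right, ← skew, e, sub_self, mul_zero]
  · intro y hy
    rw [mem_orthogonal_iff] at hy
    have hny := h.left_mul_normal hy
    have e : n z * y * r z = -y := by
      linear_combination (norm := noncomm_ring) hny * r z + y * hr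
    have e2 : v - (1 / 2 : ℝ) • (v - n z * v * r z) = (1 / 2 : ℝ) • (v + n z * v * r z) := by
      module
    rw [e2, inner_smul_left, inner_add_left, skew, e, inner_neg_right, add_neg_cancel, mul_zero]

/-! #### The mean curvature vector -/

theorem norm_I (h : IsConformalParam F n r z) :
    ‖fderiv ℝ F z Complex.I‖ = ‖fderiv ℝ F z 1‖ := by
  rw [h.apply_I_left, norm_mul, norm_of_sq h.left_sq.self_of_nhds, one_mul]

theorem inner_one_I (h : IsConformalParam F n r z) :
    inner ℝ (fderiv ℝ F z 1) (fderiv ℝ F z Complex.I) = 0 := by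
  rw [h.apply_I_right, inner_neg_right, inner_self_mul,
    re_eq_zero_of_sq h.right_sq.self_of_nhds, mul_zero, neg_zero]

theorem inducedMetric_eq (h : IsConformalParam F n r z) :
    inducedMetric F z = (‖fderiv ℝ F z 1‖ ^ 2) • (1 : Matrix (Fin 2) (Fin 2) ℝ) := by
  have h1 := h.inner_one_I
  have h2 := h1
  rw [real_inner_comm] at h2
  ext i j
  fin_cases i <;> fin_cases j <;>
    simp [inducedMetric, frame, h1, h2, h.norm_I]

/-- In a conformal coordinate the mean curvature vector is the normal part of the Laplacian divided
by `2|F_x|²`, and by `laplacian_eq` the Laplacian is `-F_x (r r_x + r_y)`. -/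
theorem norm_meanVec_sq (h : IsConformalParam F n r z) :
    ‖meanVec F z‖ ^ 2 * ‖fderiv ℝ F z 1‖ ^ 2
      = (1 / 4) * ‖r z * fderiv ℝ r z 1 + fderiv ℝ r z Complex.I‖ ^ 2 := by
  have hE : ‖fderiv ℝ F z 1‖ ≠ 0 := norm_ne_zero_iff.2 h.ne_zero
  have hna := h.mul_eq_neg_mul 1
  have hr := h.right_sq.self_of_nhds
  have a1 := h.right_anticomm 1
  have a2 := h.right_anticomm Complex.I
  -- The Laplacian is already normal: `r r_x + r_y` anticommutes with `r`, so `v ↦ n v r` changes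
  -- its sign.
  have hP : normalProj F z (-(fderiv ℝ F z 1 * (r z * fderiv ℝ r z 1 + fderiv ℝ r z Complex.I)))
      = -(fderiv ℝ F z 1 * (r z * fderiv ℝ r z 1 + fderiv ℝ r z Complex.I)) := by
    rw [h.normalProj_eq]
    generalize fderiv ℝ F z 1 = a at *
    generalize fderiv ℝ r z 1 = s at *
    generalize fderiv ℝ r z Complex.I = t at *
    have e : n z * -(a * (r z * s + t)) * r z = a * (r z * s + t) := by
      linear_combination (norm := noncomm_ring) -hna * (r z * s + t) * r z
        + a * r z * a2 - a * hr * t + a * r z * r z * a1 - a * hr * (r z * s)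
    rw [e]
    module
  have hH : meanVec F z = (1 / (2 * ‖fderiv ℝ F z 1‖ ^ 2)) •
      -(fderiv ℝ F z 1 * (r z * fderiv ℝ r z 1 + fderiv ℝ r z Complex.I)) := by
    rw [← hP, ← h.laplacian_eq, map_add, meanVec, h.inducedMetric_eq, inv_smul_one_matrix]
    simp only [Fin.sum_univ_two, Matrix.smul_apply, Matrix.one_apply, smul_eq_mul]
    simp only [if_true, zero_ne_one, one_ne_zero, if_false, mul_one, mul_zero, zero_smul,
      add_zero, zero_add, secondForm, frame, Matrix.cons_val_zero, Matrix.cons_val_one]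
    rw [← smul_add, smul_smul]
    congr 1
    field_simp
  rw [hH, norm_smul, norm_neg, norm_mul, Real.norm_of_nonneg (by positivity)]
  field_simp
  ring

/-! #### The normal curvature -/

theorem fderiv_normalField (h : IsConformalParam F n r z) (Y : ℂ) (ξ : ℍ[ℝ]) :
    fderiv ℝ (fun w => normalProj F w ξ) z Y
      = -((1 / 2 : ℝ) • (fderiv ℝ n z Y * ξ * r z + n z * ξ * fderiv ℝ r z Y)) := by
  have e : (fun w => normalProj F w ξ) =ᶠ[𝓝 z] fun w => (1 / 2 : ℝ) • (ξ - n w * ξ * r w) := by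
    filter_upwards [h.eventually] with w hw
    exact hw.normalProj_eq ξ
  have hd : DifferentiableAt ℝ (fun w => n w * ξ) z :=
    h.diff_left.mul (differentiableAt_const ξ)
  have hd2 : DifferentiableAt ℝ (fun w => n w * ξ * r w) z := hd.mul h.diff_right
  have hp := fderiv_mul_quaternion hd h.diff_right Y
  have hp2 := fderiv_mul_quaternion h.diff_left (differentiableAt_const ξ) Y
  rw [e.fderiv_eq, fderiv_fun_const_smul ((differentiableAt_const ξ).fun_sub hd2), smul_apply,
    fderiv_const_sub, neg_apply, hp, hp2]
  simp

theorem normalConn_normalField (h : IsConformalParam F n r z) (Y : ℂ) (ξ : ℍ[ℝ]) :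
    normalConn F Y (fun w => normalProj F w ξ) z
      = -((1 / 4 : ℝ) • (fderiv ℝ n z Y * (ξ * r z) + n z * ξ * fderiv ℝ r z Y
          + n z * fderiv ℝ n z Y * ξ + ξ * fderiv ℝ r z Y * r z)) := by
  have hr := h.right_sq.self_of_nhds
  have hn := h.left_sq.self_of_nhds
  rw [normalConn, h.fderiv_normalField, h.normalProj_eq]
  generalize fderiv ℝ n z Y = s
  generalize fderiv ℝ r z Y = t
  have e : n z * (s * ξ * r z + n z * ξ * t) * r z = -(n z * s * ξ + ξ * t * r z) := by
    linear_combination (norm := noncomm_ring) n z * s * ξ * hr + hn * (ξ * t * r z)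
  rw [mul_neg, neg_mul, mul_smul_comm, smul_mul_assoc, e, mul_assoc s ξ]
  module

theorem fderiv_normalConn (h : IsConformalParam F n r z) (X Y : ℂ) (ξ : ℍ[ℝ]) :
    fderiv ℝ (normalConn F Y fun w => normalProj F w ξ) z X
      = -((1 / 4 : ℝ) • (
          (fderiv ℝ (fun w => fderiv ℝ n w Y) z X * (ξ * r z)
            + fderiv ℝ n z Y * (ξ * fderiv ℝ r z X))
          + (fderiv ℝ n z X * ξ * fderiv ℝ r z Y
            + n z * ξ * fderiv ℝ (fun w => fderiv ℝ r w Y) z X)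
          + (fderiv ℝ n z X * fderiv ℝ n z Y
            + n z * fderiv ℝ (fun w => fderiv ℝ n w Y) z X) * ξ
          + (ξ * fderiv ℝ (fun w => fderiv ℝ r w Y) z X * r z
            + ξ * fderiv ℝ r z Y * fderiv ℝ r z X))) := by
  have e : (normalConn F Y fun w => normalProj F w ξ) =ᶠ[𝓝 z] fun w =>
      -((1 / 4 : ℝ) • (fderiv ℝ n w Y * (ξ * r w) + n w * ξ * fderiv ℝ r w Y
          + n w * fderiv ℝ n w Y * ξ + ξ * fderiv ℝ r w Y * r w)) := by
    filter_upwards [h.eventually] with w hw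
    exact hw.normalConn_normalField Y ξ
  have dn := h.diff_left
  have dr := h.diff_right
  have dc : DifferentiableAt ℝ (fun _ : ℂ => ξ) z := differentiableAt_const ξ
  have dnY : DifferentiableAt ℝ (fun w => fderiv ℝ n w Y) z :=
    (contDiffAt_fderiv_apply h.smooth_left (m := 1) (by norm_num) Y).differentiableAt
      (by norm_num)
  have drY : DifferentiableAt ℝ (fun w => fderiv ℝ r w Y) z :=
    (contDiffAt_fderiv_apply h.smooth_right (m := 1) (by norm_num) Y).differentiableAt
      (by norm_num)
  have d1 : DifferentiableAt ℝ (fun w => ξ * r w) z := dc.mul dr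
  have d2 : DifferentiableAt ℝ (fun w => n w * ξ) z := dn.mul dc
  have d3 : DifferentiableAt ℝ (fun w => n w * fderiv ℝ n w Y) z := dn.mul dnY
  have d4 : DifferentiableAt ℝ (fun w => ξ * fderiv ℝ r w Y) z := dc.mul drY
  have D1 : DifferentiableAt ℝ (fun w => fderiv ℝ n w Y * (ξ * r w)) z := dnY.mul d1
  have D2 : DifferentiableAt ℝ (fun w => n w * ξ * fderiv ℝ r w Y) z := d2.mul drY
  have D3 : DifferentiableAt ℝ (fun w => n w * fderiv ℝ n w Y * ξ) z := d3.mul dc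
  have D4 : DifferentiableAt ℝ (fun w => ξ * fderiv ℝ r w Y * r w) z := d4.mul dr
  rw [e.fderiv_eq, fderiv_fun_neg, fderiv_fun_const_smul (((D1.fun_add D2).fun_add D3).fun_add D4),
    fderiv_fun_add ((D1.fun_add D2).fun_add D3) D4, fderiv_fun_add (D1.fun_add D2) D3,
    fderiv_fun_add D1 D2]
  simp only [neg_apply, smul_apply, add_apply, fderiv_mul_quaternion dnY d1,
    fderiv_mul_quaternion dc dr, fderiv_mul_quaternion d2 drY, fderiv_mul_quaternion dn dc,
    fderiv_mul_quaternion d3 dc, fderiv_mul_quaternion dn dnY, fderiv_mul_quaternion d4 dr,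
    fderiv_mul_quaternion dc drY]
  simp

/-- Antisymmetrizing in `X, Y` cancels the second derivatives and the mixed terms `n_X ξ r_Y + n_Y ξ
r_X`. What is left are the commutators of the derivatives of `n` and of `r`, which are multiples of
`n` and `r` by `commutator_eq_smul`. -/
theorem normalCurvTensor_eq (h : IsConformalParam F n r z) (X Y : ℂ) {ξ : ℍ[ℝ]}
    (hξ : ∀ v, inner ℝ (fderiv ℝ F z v) ξ = 0) :
    normalCurvTensor F z X Y ξ
      = ((1 / 2) * (inner ℝ (r z * fderiv ℝ r z X) (fderiv ℝ r z Y)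
          - inner ℝ (n z * fderiv ℝ n z X) (fderiv ℝ n z Y))) • (n z * ξ) := by
  have hr := h.right_sq.self_of_nhds
  have hn := h.left_sq.self_of_nhds
  have hnξ := h.left_mul_normal hξ
  have cn := commutator_eq_smul hn (h.left_anticomm X) (h.left_anticomm Y)
  have cr := commutator_eq_smul hr (h.right_anticomm X) (h.right_anticomm Y)
  have key : fderiv ℝ (normalConn F Y fun w => normalProj F w ξ) z X
      - fderiv ℝ (normalConn F X fun w => normalProj F w ξ) z Y
      = -((1 / 4 : ℝ) • ((fderiv ℝ n z X * fderiv ℝ n z Y - fderiv ℝ n z Y * fderiv ℝ n z X) * ξ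
        - ξ * (fderiv ℝ r z X * fderiv ℝ r z Y - fderiv ℝ r z Y * fderiv ℝ r z X))) := by
    rw [h.fderiv_normalConn, h.fderiv_normalConn, fderiv_fderiv_comm h.smooth_left X Y,
      fderiv_fderiv_comm h.smooth_right X Y, neg_sub_neg, ← smul_sub, ← smul_neg]
    congr 1
    noncomm_ring
  rw [normalCurvTensor]
  simp only [normalConn]
  rw [← map_sub]
  rw [key, cn, cr, smul_mul_assoc, mul_smul_comm, ← hnξ, ← sub_smul, smul_smul, ← neg_smul,
    map_smul, h.normalProj_eq]
  have e : n z * (n z * ξ) * r z = -(n z * ξ) := by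
    linear_combination (norm := noncomm_ring) hn * (ξ * r z) + hnξ
  rw [e]
  module

/-- `⟨q dq(X), dq(Y)⟩` evaluated on `X`, `Y = i X`. -/
theorem inner_mul_fderiv_I {q : ℍ[ℝ]} (hq : q.re = 0) (T : ℂ →L[ℝ] ℍ[ℝ]) (X : ℂ) :
    inner ℝ (q * T X) (T (Complex.I * X)) = ‖X‖ ^ 2 * inner ℝ (q * T 1) (T Complex.I) := by
  have hs : ∀ x, inner ℝ (q * x) x = 0 := by
    intro x
    have := inner_imaginary_mul hq x x
    rw [real_inner_comm (q * x) x] at this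
    linarith
  have hc : inner ℝ (q * T Complex.I) (T 1) = - inner ℝ (q * T 1) (T Complex.I) := by
    rw [inner_imaginary_mul hq, real_inner_comm]
  rw [fderiv_eq_re_im T X, fderiv_eq_re_im T (Complex.I * X), Complex.sq_norm,
    Complex.normSq_apply]
  simp only [mul_add, mul_smul_comm, inner_add_left, inner_add_right, real_inner_smul_left,
    real_inner_smul_right, hs, hc, Complex.mul_re, Complex.mul_im, Complex.I_re, Complex.I_im]
  ring

theorem norm_fderiv (h : IsConformalParam F n r z) (X : ℂ) :
    ‖fderiv ℝ F z X‖ ^ 2 = ‖X‖ ^ 2 * ‖fderiv ℝ F z 1‖ ^ 2 := by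
  rw [fderiv_eq_re_im (fderiv ℝ F z) X, norm_add_sq_real, norm_smul, norm_smul, h.norm_I,
    real_inner_smul_left, real_inner_smul_right, h.inner_one_I, Complex.sq_norm,
    Complex.normSq_apply, mul_pow, mul_pow, Real.norm_eq_abs, Real.norm_eq_abs, sq_abs, sq_abs]
  ring

theorem normalCurvature_eq (h : IsConformalParam F n r z) {U : ℂ} {ξ : ℍ[ℝ]}
    (hU : ‖fderiv ℝ F z U‖ = 1) (hξ1 : ‖ξ‖ = 1)
    (hξ : ∀ v, inner ℝ (fderiv ℝ F z v) ξ = 0) :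
    inner ℝ (normalCurvTensor F z U (Complex.I * U) ξ) (n z * ξ) * ‖fderiv ℝ F z 1‖ ^ 2
      = (1 / 2) * (inner ℝ (r z * fderiv ℝ r z 1) (fderiv ℝ r z Complex.I)
          - inner ℝ (n z * fderiv ℝ n z 1) (fderiv ℝ n z Complex.I)) := by
  have hr := h.right_sq.self_of_nhds
  have hn := h.left_sq.self_of_nhds
  have hU2 := h.norm_fderiv U
  rw [hU] at hU2
  rw [h.normalCurvTensor_eq U _ hξ, real_inner_smul_left, real_inner_self_eq_norm_sq, norm_mul,
    norm_of_sq hn, hξ1, inner_mul_fderiv_I (re_eq_zero_of_sq hr),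
    inner_mul_fderiv_I (re_eq_zero_of_sq hn)]
  linear_combination (-(1 / 2) * (inner ℝ (r z * fderiv ℝ r z 1) (fderiv ℝ r z Complex.I)
          - inner ℝ (n z * fderiv ℝ n z 1) (fderiv ℝ n z Complex.I))) * hU2

/-! #### The Gaussian curvature -/

theorem pd_norm_sq {x : ℂ → ℍ[ℝ]} (hx : DifferentiableAt ℝ x z) (i : Fin 2) :
    pd i (fun w => ‖x w‖ ^ 2) z = 2 * inner ℝ (x z) (fderiv ℝ x z (frame i)) := by
  simp only [← real_inner_self_eq_norm_sq]
  rw [pd, fderiv_inner_apply ℝ hx hx, real_inner_comm (x z)]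
  ring

/-- The Theorema egregium in conformal coordinates: the Laplacian of the conformal factor in terms
of second derivatives. -/
theorem laplacian_norm_sq (h : IsConformalParam F n r z) :
    pd 0 (pd 0 fun w => ‖fderiv ℝ F w 1‖ ^ 2) z + pd 1 (pd 1 fun w => ‖fderiv ℝ F w 1‖ ^ 2) z
      = 2 * (‖fderiv ℝ (fun w => fderiv ℝ F w Complex.I) z 1‖ ^ 2
        - inner ℝ (fderiv ℝ (fun w => fderiv ℝ F w 1) z 1)
            (fderiv ℝ (fun w => fderiv ℝ F w Complex.I) z Complex.I)) := by
  set a : ℂ → ℍ[ℝ] := fun w => fderiv ℝ F w 1 with ha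
  set b : ℂ → ℍ[ℝ] := fun w => fderiv ℝ F w Complex.I with hb
  set c : ℂ → ℍ[ℝ] := fun w => fderiv ℝ b w 1 with hc
  set k : ℂ → ℍ[ℝ] := fun w => fderiv ℝ a w 1 with hk
  have da : DifferentiableAt ℝ a z := h.diff_partial 1
  have db : DifferentiableAt ℝ b z := h.diff_partial Complex.I
  have dc : DifferentiableAt ℝ c z :=
    (contDiffAt_fderiv_apply (h.smooth_partial Complex.I) (m := 1) (by norm_num) 1).differentiableAt
      (by norm_num)
  have dk : DifferentiableAt ℝ k z :=
    (contDiffAt_fderiv_apply (h.smooth_partial 1) (m := 1) (by norm_num) 1).differentiableAt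
      (by norm_num)
  have hac : fderiv ℝ a z Complex.I = c z := h.snd_comm Complex.I 1
  have hce : (fun w => fderiv ℝ a w Complex.I) =ᶠ[𝓝 z] c := by
    filter_upwards [h.eventually] with w hw
    exact hw.snd_comm Complex.I 1
  have hkc : fderiv ℝ k z Complex.I = fderiv ℝ c z 1 := by
    rw [hk, fderiv_fderiv_comm (h.smooth_partial 1) Complex.I 1, hce.fderiv_eq]
  -- By conformality `|F_x|² = |F_y|²`. Using `F_y` for the `x`-derivative makes `F_xy` appear in
  -- both first derivatives.
  have e0 : (pd 0 fun w => ‖a w‖ ^ 2) =ᶠ[𝓝 z] fun w => 2 * inner ℝ (b w) (c w) := by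
    filter_upwards [h.eventually.eventually_nhds, h.eventually] with w hw hw'
    have e : (fun y => ‖a y‖ ^ 2) =ᶠ[𝓝 w] fun y => ‖b y‖ ^ 2 := by
      filter_upwards [hw] with y hy
      rw [ha, hb]
      simp only [hy.norm_I]
    rw [pd_congr e, pd_norm_sq (hw'.diff_partial Complex.I)]
    rfl
  have e1 : (pd 1 fun w => ‖a w‖ ^ 2) =ᶠ[𝓝 z] fun w => 2 * inner ℝ (a w) (c w) := by
    filter_upwards [h.eventually, hce] with w hw hw'
    rw [pd_norm_sq (hw.diff_partial 1), ← hw']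
    rfl
  have p0 : pd 0 (fun w => 2 * inner ℝ (b w) (c w)) z
      = 2 * (inner ℝ (b z) (fderiv ℝ c z 1) + inner ℝ (c z) (c z)) := by
    rw [pd, fderiv_const_mul (db.inner ℝ dc), smul_apply, fderiv_inner_apply ℝ db dc]
    rfl
  have p1 : pd 1 (fun w => 2 * inner ℝ (a w) (c w)) z
      = 2 * (inner ℝ (a z) (fderiv ℝ c z Complex.I) + inner ℝ (c z) (c z)) := by
    rw [pd, fderiv_const_mul (da.inner ℝ dc), smul_apply, fderiv_inner_apply ℝ da dc]
    simp [frame, hac]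
  have orth : (fun w => inner ℝ (a w) (c w) + inner ℝ (k w) (b w)) =ᶠ[𝓝 z] fun _ => 0 := by
    filter_upwards [h.eventually.eventually_nhds, h.eventually] with w hw hw'
    have e : (fun y => inner ℝ (a y) (b y)) =ᶠ[𝓝 w] fun _ => 0 := by
      filter_upwards [hw] with y hy
      exact hy.inner_one_I
    have e2 := congrArg (fun T : ℂ →L[ℝ] ℝ => T 1) e.fderiv_eq
    have daw : DifferentiableAt ℝ a w := hw'.diff_partial 1
    have dbw : DifferentiableAt ℝ b w := hw'.diff_partial Complex.I
    simpa [fderiv_inner_apply ℝ daw dbw] using e2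
  -- Differentiating `⟨F_x, F_y⟩ = 0` in `x` and then in `y` produces the same third-order terms as
  -- the Laplacian and so eliminates them.
  have rel := congrArg (fun T : ℂ →L[ℝ] ℝ => T Complex.I) orth.fderiv_eq
  simp only [fderiv_fun_add (da.inner ℝ dc) (dk.inner ℝ db), add_apply,
    fderiv_inner_apply ℝ da dc, fderiv_inner_apply ℝ dk db, hac, hkc, fderiv_fun_const,
    Pi.zero_apply, zero_apply] at rel
  rw [pd_congr e0, pd_congr e1, p0, p1, ← real_inner_self_eq_norm_sq]
  rw [real_inner_comm] at rel
  linarith [real_inner_comm (b z) (fderiv ℝ c z 1), real_inner_comm (a z) (fderiv ℝ c z Complex.I)]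

/-- The induced curvature is half the sum of the signed area densities of the two normals. All
derivatives are expressed through `F_x`, its logarithmic derivative and `dr`; after cancelling
`|F_x|²` the claim is `gauss_algebra`. -/
theorem gaussOfMetric_eq (h : IsConformalParam F n r z) :
    gaussOfMetric (inducedMetric F) z * ‖fderiv ℝ F z 1‖ ^ 2
      = (1 / 2) * (inner ℝ (r z * fderiv ℝ r z 1) (fderiv ℝ r z Complex.I)
          + inner ℝ (n z * fderiv ℝ n z 1) (fderiv ℝ n z Complex.I)) := by
  have hr := h.right_sq.self_of_nhds
  have hr0 := re_eq_zero_of_sq hr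
  have hs := h.right_anticomm 1
  have ht := h.right_anticomm Complex.I
  have hs0 := re_eq_zero_of_anticomm hr hs
  have hne := h.ne_zero
  have hE : ‖fderiv ℝ F z 1‖ ^ 2 ≠ 0 := pow_ne_zero 2 (norm_ne_zero_iff.2 hne)
  have hmet : inducedMetric F =ᶠ[𝓝 z]
      fun w => (‖fderiv ℝ F w 1‖ ^ 2) • (1 : Matrix (Fin 2) (Fin 2) ℝ) := by
    filter_upwards [h.eventually] with w hw
    exact hw.inducedMetric_eq
  have hna := h.mul_eq_neg_mul 1
  have hlap := h.laplacian_eq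
  have hc := h.snd_right 1
  have hnx := h.snd_left 1
  have hny := h.snd_left Complex.I
  have p0 : pd 0 (fun w => ‖fderiv ℝ F w 1‖ ^ 2) z
      = 2 * inner ℝ (fderiv ℝ F z 1) (fderiv ℝ (fun w => fderiv ℝ F w 1) z 1) := by
    rw [pd_norm_sq (h.diff_partial 1)]
    rfl
  have p1 : pd 1 (fun w => ‖fderiv ℝ F w 1‖ ^ 2) z
      = 2 * inner ℝ (fderiv ℝ F z 1) (fderiv ℝ (fun w => fderiv ℝ F w Complex.I) z 1) := by
    rw [pd_norm_sq (h.diff_partial 1), ← h.snd_comm Complex.I 1]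
    rfl
  rw [gaussOfMetric_conformal hmet ((h.smooth_partial 1).norm_sq ℝ) hE, h.laplacian_norm_sq,
    p0, p1]
  rw [h.snd_comm Complex.I 1] at hny
  have hn2 := h.left_sq.self_of_nhds
  generalize fderiv ℝ (fun w => fderiv ℝ F w Complex.I) z Complex.I = byy at *
  generalize fderiv ℝ (fun w => fderiv ℝ F w Complex.I) z 1 = c at *
  generalize fderiv ℝ (fun w => fderiv ℝ F w 1) z 1 = ax at *
  generalize fderiv ℝ F z 1 = a at *
  generalize fderiv ℝ r z 1 = s at *
  generalize fderiv ℝ r z Complex.I = t at *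
  generalize fderiv ℝ n z 1 = nx at *
  generalize fderiv ℝ n z Complex.I = ny at *
  generalize r z = r at *
  generalize n z = n at *
  obtain ⟨α, rfl⟩ : ∃ α, ax = a * α := ⟨a⁻¹ * ax, (mul_inv_cancel_left₀ hne ax).symm⟩
  have hc' : c = a * -(α * r + s) := by
    linear_combination (norm := noncomm_ring) hc
  have hb' : byy = a * (-α - r * s - t) := by
    linear_combination (norm := noncomm_ring) hlap
  have hnx' : n * nx * a = a * (α + r * α * r + r * s) := by
    rw [hc'] at hnx
    linear_combination (norm := noncomm_ring) -n * hnx - hna * (α * r + s) - hn2 * (a * α)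
  have hny' : ny * a = a * -(α + r * α * r + 2 * (r * s) + t) := by
    rw [hb', hc'] at hny
    linear_combination (norm := noncomm_ring) -hny + hna * (α * r + s)
  -- Right multiplication by `a` scales inner products by `|a|²`; it moves the derivatives of `n`
  -- into the form `a * _`, where they are known in terms of `r`.
  have hν : inner ℝ (n * nx) ny
      = -inner ℝ (α + r * α * r + r * s) (α + r * α * r + 2 * (r * s) + t) := by
    have e := inner_mul_mul_right a (n * nx) ny
    rw [hnx', hny', inner_mul_mul_left, inner_neg_right] at e
    exact (mul_left_cancel₀ hE e).symm
  have hre : inner ℝ a c = ‖a‖ ^ 2 * inner ℝ α r := by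
    rw [hc', inner_self_mul]
    congr 1
    simp only [Quaternion.re_neg, Quaternion.re_add, Quaternion.re_mul, hs0, hr0,
      inner_eq_components]
    ring
  have G := gauss_algebra (α := α) hr hs ht
  rw [hν, hre, inner_self_mul, hb', inner_mul_mul_left, hc', norm_mul, norm_neg]
  rw [← sub_eq_add_neg, ← G]
  have hE' : ‖a‖ ≠ 0 := norm_ne_zero_iff.2 hne
  field_simp
  ring

/-! #### The Willmore integrand of a conformal parametrization -/

theorem norm_right_form (h : IsConformalParam F n r z) (X : ℂ) :
    ‖r z * fderiv ℝ r z X - fderiv ℝ r z (Complex.I * X)‖ ^ 2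
      = ‖X‖ ^ 2 * ‖r z * fderiv ℝ r z 1 - fderiv ℝ r z Complex.I‖ ^ 2 := by
  have hr := h.right_sq.self_of_nhds
  -- Replacing `X` by `iX` multiplies the form on the left by `-r`, so `X = x + iy` acts by `x - y
  -- r`, a quaternion of norm `|X|`.
  have e : r z * fderiv ℝ r z X - fderiv ℝ r z (Complex.I * X)
      = ((X.re : ℝ) • (1 : ℍ[ℝ]) - (X.im : ℝ) • r z)
        * (r z * fderiv ℝ r z 1 - fderiv ℝ r z Complex.I) := by
    rw [fderiv_eq_re_im (fderiv ℝ r z) X, fderiv_eq_re_im (fderiv ℝ r z) (Complex.I * X)]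
    simp only [Complex.mul_re, Complex.mul_im, Complex.I_re, Complex.I_im, mul_add,
      mul_smul_comm, sub_mul, mul_sub, smul_mul_assoc, one_mul, ← mul_assoc, hr,
      neg_mul]
    module
  rw [e, norm_mul, mul_pow]
  congr 1
  rw [norm_sub_sq_real, norm_smul, norm_smul, norm_of_sq hr, real_inner_smul_left,
    real_inner_smul_right, Complex.sq_norm, Complex.normSq_apply]
  have : inner ℝ (1 : ℍ[ℝ]) (r z) = 0 := by
    rw [inner_eq_components, re_eq_zero_of_sq hr]
    simp
  rw [this, norm_one, mul_one, mul_one, Real.norm_eq_abs, Real.norm_eq_abs, sq_abs, sq_abs]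
  ring

theorem right_form_eq (h : IsConformalParam F n r z) (X : ℂ) :
    (1 / 16) * ‖r z * fderiv ℝ r z X - fderiv ℝ r z (Complex.I * X)‖ ^ 2
      = (1 / 4) * (‖meanVec F z‖ ^ 2 * ‖fderiv ℝ F z X‖ ^ 2
        - ‖X‖ ^ 2 * inner ℝ (r z * fderiv ℝ r z 1) (fderiv ℝ r z Complex.I)) := by
  rw [h.norm_right_form, norm_sub_sq_eq_norm_add_sq, h.norm_fderiv]
  linear_combination (-(1 / 4) * ‖X‖ ^ 2) * h.norm_meanVec_sq

theorem right_form_eq_curvature (h : IsConformalParam F n r z) (X : ℂ) {U : ℂ} {ξ : ℍ[ℝ]}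
    (hU : ‖fderiv ℝ F z U‖ = 1) (hξ1 : ‖ξ‖ = 1)
    (hξ : ∀ v, inner ℝ (fderiv ℝ F z v) ξ = 0) :
    (1 / 16) * ‖r z * fderiv ℝ r z X - fderiv ℝ r z (Complex.I * X)‖ ^ 2
      = (1 / 4) * (‖meanVec F z‖ ^ 2 - gaussOfMetric (inducedMetric F) z
        - inner ℝ (normalCurvTensor F z U (Complex.I * U) ξ) (n z * ξ))
        * ‖fderiv ℝ F z X‖ ^ 2 := by
  rw [h.right_form_eq, h.norm_fderiv X]
  linear_combination (1 / 4 * ‖X‖ ^ 2) * (h.gaussOfMetric_eq + h.normalCurvature_eq hU hξ1 hξ)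

/-- If the left and right normals agree, the normal curvature does not contribute. -/
theorem right_form_eq_of_normals_eq (h : IsConformalParam F n n z) (X : ℂ) :
    (1 / 16) * ‖n z * fderiv ℝ n z X - fderiv ℝ n z (Complex.I * X)‖ ^ 2
      = (1 / 4) * (‖meanVec F z‖ ^ 2 - gaussOfMetric (inducedMetric F) z)
        * ‖fderiv ℝ F z X‖ ^ 2 := by
  rw [h.right_form_eq, h.norm_fderiv X]
  linear_combination (1 / 4 * ‖X‖ ^ 2) * h.gaussOfMetric_eq

end IsConformalParam

/-! ### Passing to holomorphic charts -/

section Charts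

variable {M : Type*} [TopologicalSpace M] [ChartedSpace ℂ M]

theorem J_J (p : M) (X : Tang p) : J p (J p X) = -X := by
  have key : ∀ x : ℂ, Complex.I * (Complex.I * x) = -x := fun x => by
    rw [← mul_assoc, Complex.I_mul_I, neg_one_mul]
  exact key X

/-- The coordinate vector `∂/∂x` at `p`. -/
def coordVec (p : M) : Tang p := (1 : ℂ)

theorem exists_eq_coordVec (p : M) (X : Tang p) :
    ∃ s t : ℝ, X = s • coordVec p + t • J p (coordVec p) := by
  have key : ∀ x : ℂ, x = x.re • (1 : ℂ) + x.im • (Complex.I * 1) := fun x => by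
    simp [Complex.re_add_im]
  exact ⟨_, _, key X⟩

theorem contDiffAt_localRep {g : M → ℍ[ℝ]} (hg : SmoothFun g) (p : M) :
    ContDiffAt ℝ ∞ (localRep g p) (chartAt ℂ p p) := by
  have h := (contMDiffAt_iff.1 (hg p)).2
  simp only [mfld_simps, contDiffWithinAt_univ] at h
  exact h

theorem dd_apply {g : M → ℍ[ℝ]} (hg : SmoothFun g) (p : M) (X : Tang p) :
    dd g p X = fderiv ℝ (localRep g p) (chartAt ℂ p p) X := by
  have h : MDifferentiableAt 𝓘(ℝ, ℂ) 𝓘(ℝ, ℍ[ℝ]) g p := (hg p).mdifferentiableAt (by simp)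
  have e := h.mfderiv
  simp only [mfld_simps, fderivWithin_univ] at e
  rw [dd, e]
  rfl

theorem dd_coordVec {g : M → ℍ[ℝ]} (hg : SmoothFun g) (p : M) :
    dd g p (coordVec p) = fderiv ℝ (localRep g p) (chartAt ℂ p p) 1 :=
  dd_apply hg p _

theorem dd_J_coordVec {g : M → ℍ[ℝ]} (hg : SmoothFun g) (p : M) :
    dd g p (J p (coordVec p)) = fderiv ℝ (localRep g p) (chartAt ℂ p p) Complex.I := by
  rw [dd_apply hg]
  exact congrArg _ (mul_one Complex.I)

theorem differentiableAt_localRep {g : M → ℍ[ℝ]} (hg : SmoothFun g) (p : M) :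
    DifferentiableAt ℝ (localRep g p) (chartAt ℂ p p) :=
  (contDiffAt_localRep hg p).differentiableAt (by simp)

theorem localRep_self (g : M → ℍ[ℝ]) (p : M) : localRep g p (chartAt ℂ p p) = g p := by
  simp [localRep]

theorem SmoothFun.mul {g h : M → ℍ[ℝ]} (hg : SmoothFun g) (hh : SmoothFun h) :
    SmoothFun fun q => g q * h q := by
  have hm : ContDiff ℝ ∞ fun x : ℍ[ℝ] × ℍ[ℝ] => x.1 * x.2 := contDiff_mul
  exact hm.contMDiff.comp (hg.prodMk_space hh)

theorem SmoothFun.add {g h : M → ℍ[ℝ]} (hg : SmoothFun g) (hh : SmoothFun h) :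
    SmoothFun fun q => g q + h q :=
  ContMDiff.add hg hh

theorem SmoothFun.sub {g h : M → ℍ[ℝ]} (hg : SmoothFun g) (hh : SmoothFun h) :
    SmoothFun fun q => g q - h q :=
  ContMDiff.sub hg hh

theorem SmoothFun.neg {g : M → ℍ[ℝ]} (hg : SmoothFun g) : SmoothFun fun q => -g q :=
  ContMDiff.neg hg

theorem smoothFun_const (c : ℍ[ℝ]) : SmoothFun fun _ : M => c := contMDiff_const

theorem dd_mul {g h : M → ℍ[ℝ]} (hg : SmoothFun g) (hh : SmoothFun h) (p : M) (X : Tang p) :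
    dd (fun q => g q * h q) p X = dd g p X * h p + g p * dd h p X := by
  rw [dd_apply (hg.mul hh), dd_apply hg, dd_apply hh]
  have e := fderiv_mul_quaternion (differentiableAt_localRep hg p)
    (differentiableAt_localRep hh p) X
  rwa [localRep_self, localRep_self] at e

theorem dd_add {g h : M → ℍ[ℝ]} (hg : SmoothFun g) (hh : SmoothFun h) (p : M) (X : Tang p) :
    dd (fun q => g q + h q) p X = dd g p X + dd h p X := by
  rw [dd_apply (hg.add hh), dd_apply hg, dd_apply hh]
  have e := fderiv_fun_add (differentiableAt_localRep hg p) (differentiableAt_localRep hh p)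
  exact congrArg (fun T : ℂ →L[ℝ] ℍ[ℝ] => T X) e

theorem dd_sub {g h : M → ℍ[ℝ]} (hg : SmoothFun g) (hh : SmoothFun h) (p : M) (X : Tang p) :
    dd (fun q => g q - h q) p X = dd g p X - dd h p X := by
  rw [dd_apply (hg.sub hh), dd_apply hg, dd_apply hh]
  have e := fderiv_fun_sub (differentiableAt_localRep hg p) (differentiableAt_localRep hh p)
  exact congrArg (fun T : ℂ →L[ℝ] ℍ[ℝ] => T X) e

theorem dd_neg {g : M → ℍ[ℝ]} (hg : SmoothFun g) (p : M) (X : Tang p) :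
    dd (fun q => -g q) p X = -dd g p X := by
  rw [dd_apply hg.neg, dd_apply hg]
  have e := fderiv_fun_neg (𝕜 := ℝ) (f := localRep g p) (x := chartAt ℂ p p)
  exact congrArg (fun T : ℂ →L[ℝ] ℍ[ℝ] => T X) e

theorem dd_const (c : ℍ[ℝ]) (p : M) (X : Tang p) : dd (fun _ : M => c) p X = 0 := by
  rw [dd, mfderiv_const]
  rfl

theorem IsConformalImmersion.dd_coordVec_ne_zero {f N R : M → ℍ[ℝ]}
    (hf : IsConformalImmersion f N R) (p : M) : dd f p (coordVec p) ≠ 0 := by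
  intro h
  have := hf.immersion p (h.trans (map_zero (dd f p)).symm)
  exact one_ne_zero (α := ℂ) this

/-- The differential of `localRep f p` at nearby points factors through `dd f` and a complex
linear coordinate change. -/
theorem exists_fderiv_localRep [IsManifold 𝓘(ℂ, ℂ) ω M] {f : M → ℍ[ℝ]} (hf : SmoothFun f)
    (p : M) {w : ℂ} (hw : w ∈ (chartAt ℂ p).target) :
    ∃ T : ℂ →L[ℂ] ℂ, ∀ v : ℂ, fderiv ℝ (localRep f p) w v
      = dd f ((chartAt ℂ p).symm w) (T v : ℂ) := by
  set q := (chartAt ℂ p).symm w with hq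
  set τ : ℂ → ℂ := fun y => chartAt ℂ q ((chartAt ℂ p).symm y) with hτ
  have hτd : DifferentiableAt ℂ τ w := by
    have h := contDiffWithinAt_ext_coord_change (I := 𝓘(ℂ, ℂ)) (n := ω) q p (y := w)
      (by simp [mfld_simps, hw, ← hq])
    have h2 : ContDiffAt ℂ ω τ w := by
      simpa [mfld_simps, contDiffWithinAt_univ, Function.comp_def] using h
    exact h2.differentiableAt (by simp)
  have hτr : HasFDerivAt τ ((fderiv ℂ τ w).restrictScalars ℝ) w :=
    hτd.hasFDerivAt.restrictScalars ℝ
  have hτw : τ w = chartAt ℂ q q := by rw [hτ, hq]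
  have hloc : localRep f p =ᶠ[𝓝 w] localRep f q ∘ τ := by
    have hcont : ContinuousAt (chartAt ℂ p).symm w := (chartAt ℂ p).continuousAt_symm hw
    filter_upwards [hcont.eventually ((chartAt ℂ q).open_source.mem_nhds
      (hq ▸ mem_chart_source ℂ q))] with y hy
    simp only [localRep, Function.comp, hτ]
    rw [(chartAt ℂ q).left_inv hy]
  refine ⟨fderiv ℂ τ w, fun v => ?_⟩
  have hd : HasFDerivAt (localRep f q) (fderiv ℝ (localRep f q) (τ w)) (τ w) := by
    rw [hτw]
    exact (differentiableAt_localRep hf q).hasFDerivAt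
  rw [hloc.fderiv_eq, (hd.comp w hτr).fderiv, hτw]
  exact (dd_apply hf q _).symm

/-- The hypotheses on `f` refer at each point to the preferred chart of that point. Transition maps
have complex linear differentials, so the relations also hold near `p` in the single chart at `p`.
-/
theorem IsConformalImmersion.isConformalParam [IsManifold 𝓘(ℂ, ℂ) ω M] {f N R : M → ℍ[ℝ]}
    (hf : IsConformalImmersion f N R) (hN : SmoothFun N) (hR : SmoothFun R) (p : M) :
    IsConformalParam (localRep f p) (localRep N p) (localRep R p) (chartAt ℂ p p) where
  smooth := mod_cast contDiffAt_infty.1 (contDiffAt_localRep hf.smooth p) 3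
  smooth_left := mod_cast contDiffAt_infty.1 (contDiffAt_localRep hN p) 2
  smooth_right := mod_cast contDiffAt_infty.1 (contDiffAt_localRep hR p) 2
  left_sq := Eventually.of_forall fun _ => hf.N_sq _
  right_sq := Eventually.of_forall fun _ => hf.R_sq _
  left := by
    filter_upwards [(chartAt ℂ p).open_target.mem_nhds (mem_chart_target ℂ p)] with w hw v
    obtain ⟨T, hT⟩ := exists_fderiv_localRep hf.smooth p hw
    rw [hT, hT, ← smul_eq_mul Complex.I v, map_smul]
    exact hf.left _ _
  right := by
    filter_upwards [(chartAt ℂ p).open_target.mem_nhds (mem_chart_target ℂ p)] with w hw v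
    obtain ⟨T, hT⟩ := exists_fderiv_localRep hf.smooth p hw
    rw [hT, hT, ← smul_eq_mul Complex.I v, map_smul]
    exact hf.right _ _
  ne_zero := by
    rw [← dd_coordVec hf.smooth p]
    exact hf.dd_coordVec_ne_zero p

end Charts

/-! ### The real trace -/

section Trace

/-- Left multiplication by `b` on `ℍ = ℝ⁴` has real trace `4 Re b`, and only the diagonal blocks
contribute. -/
theorem avg_eq (B : EndHH) : avg B = (1 / 2) * ((B 0 0).re + (B 1 1).re) := by
  let e : Module.Basis (Fin 4) ℝ ℍ[ℝ] := QuaternionAlgebra.basisOneIJK (-1 : ℝ) 0 (-1)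
  have hr : ∀ (q : ℍ[ℝ]) (i : Fin 4), e.repr q i = ![q.re, q.imI, q.imJ, q.imK] i :=
    fun _ _ => rfl
  have he : ∀ (i : Fin 4), e i = (![⟨1, 0, 0, 0⟩, ⟨0, 1, 0, 0⟩, ⟨0, 0, 1, 0⟩, ⟨0, 0, 0, 1⟩] :
      Fin 4 → ℍ[ℝ]) i := by
    intro i
    apply e.repr.injective
    rw [e.repr_self]
    ext j
    rw [hr]
    fin_cases i <;> fin_cases j <;> simp
  rw [avg, LinearMap.trace_eq_matrix_trace ℝ (Pi.basis fun _ : Fin 2 => e), Matrix.trace,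
    Fintype.sum_sigma]
  have key : ∀ (i : Fin 2) (j : Fin 4), Matrix.diag (LinearMap.toMatrix
      (Pi.basis fun _ : Fin 2 => e) (Pi.basis fun _ : Fin 2 => e) (realEnd B)) ⟨i, j⟩
      = e.repr (B i i * e j) j := by
    intro i j
    rw [Matrix.diag_apply, LinearMap.toMatrix_apply, Pi.basis_repr, Pi.basis_apply]
    fin_cases i <;> simp [realEnd]
  simp only [key, Fin.sum_univ_two, Fin.sum_univ_four, hr, he, Matrix.cons_val,
    Quaternion.re_mul, Quaternion.imI_mul, Quaternion.imJ_mul, Quaternion.imK_mul]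
  ring

theorem avg_sub (B C : EndHH) : avg (B - C) = avg B - avg C := by
  simp only [avg_eq, Matrix.sub_apply, Quaternion.re_sub]
  ring

theorem avg_neg (B : EndHH) : avg (-B) = -avg B := by
  simp only [avg_eq, Matrix.neg_apply, Quaternion.re_neg]
  ring

/-- The trace of the square of an endomorphism with image in the line spanned by `(x, 1)`. -/
theorem avg_sq_of_range {B : EndHH} {x : ℍ[ℝ]} (h0 : B 0 0 = x * B 1 0)
    (h1 : B 0 1 = x * B 1 1) :
    avg (B * B) = (1 / 2) * ((B 1 0 * x + B 1 1) * (B 1 0 * x + B 1 1)).re := by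
  rw [avg_eq, Matrix.mul_apply, Matrix.mul_apply, Fin.sum_univ_two, Fin.sum_univ_two, h0, h1]
  have e3 := re_mul_comm x (B 1 0 * (x * B 1 0) + B 1 1 * B 1 0)
  have e : (B 1 0 * x + B 1 1) * (B 1 0 * x + B 1 1)
      = (B 1 0 * (x * B 1 0) + B 1 1 * B 1 0) * x + (B 1 0 * (x * B 1 1) + B 1 1 * B 1 1) := by
    noncomm_ring
  have e' : x * B 1 0 * (x * B 1 0) + x * B 1 1 * B 1 0
      = x * (B 1 0 * (x * B 1 0) + B 1 1 * B 1 0) := by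
    noncomm_ring
  rw [e, e', e3, Quaternion.re_add _ (B 1 0 * (x * B 1 1) + B 1 1 * B 1 1)]

theorem re_mul_self_of_re_eq_zero {b : ℍ[ℝ]} (hb : b.re = 0) : (b * b).re = -‖b‖ ^ 2 := by
  rw [norm_sq_eq_components, Quaternion.re_mul, hb]
  ring

end Trace

/-! ### The mean curvature sphere in coordinates -/

section Sphere

variable {M : Type*} [TopologicalSpace M] [ChartedSpace ℂ M] {f N R : M → ℍ[ℝ]} {S : M → EndHH}

theorem mem_line_iff {M : Type*} {f : M → ℍ[ℝ]} {p : M} {v : HH} : v ∈ line f p ↔ v 0 = f p * v 1 := by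
  rw [line, Submodule.mem_span_singleton]
  constructor
  · rintro ⟨c, rfl⟩
    simp
  · intro h
    refine ⟨MulOpposite.op (v 1), ?_⟩
    ext1 i
    fin_cases i
    · simp [h]
    · simp

theorem base_mem_line {M : Type*} {f : M → ℍ[ℝ]} (p : M) : ![f p, 1] ∈ line f p := by
  rw [mem_line_iff]
  simp

theorem isSection_base (hf : SmoothFun f) : IsSection f fun q => ![f q, 1] := by
  refine ⟨fun i => ?_, base_mem_line⟩
  fin_cases i
  · exact hf
  · exact smoothFun_const 1

theorem hopfA_neg (S : M → EndHH) (p : M) (X : Tang p) : hopfA S p (-X) = -hopfA S p X := by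
  have h : ∀ Y : Tang p, dEnd S p (-Y) = -dEnd S p Y := by
    intro Y
    ext1 i j
    simp [dEnd]
  rw [hopfA, hopfA, map_neg, h, h, mul_neg, ← neg_add, smul_neg]

namespace IsMeanCurvatureSphere

theorem line_eq (hS : IsMeanCurvatureSphere f S) (p : M) :
    S p 0 0 * f p + S p 0 1 = f p * (S p 1 0 * f p + S p 1 1) := by
  have h : (S p).mulVec ![f p, 1] ∈ (line f p : Set HH) := by
    rw [← hS.map_line p]
    exact ⟨_, base_mem_line p, rfl⟩
  have h2 := mem_line_iff.1 h
  simpa [Matrix.mulVec, dotProduct, Fin.sum_univ_two] using h2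

/-- `S` maps `(f, 1)` to `(f, 1) λ` with `λ = S₁₀ f + S₁₁`, and `*δ = δ S` applied to this section
reads `*df = df λ`. -/
theorem right_eq (hS : IsMeanCurvatureSphere f S) (hf : IsConformalImmersion f N R) (p : M) :
    R p = -(S p 1 0 * f p + S p 1 1) := by
  have sl : SmoothFun fun q => S q 1 0 * f q + S q 1 1 :=
    ((hS.smooth 1 0).mul hf.smooth).add (hS.smooth 1 1)
  have h := mem_line_iff.1
    (hS.star_delta_eq_delta_S _ (isSection_base hf.smooth) p (coordVec p))
  have e0 : (fun q => (S q).mulVec ![f q, 1] 0)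
      = fun q => f q * (S q 1 0 * f q + S q 1 1) := by
    funext q
    rw [← hS.line_eq q]
    simp [Matrix.mulVec, dotProduct, Fin.sum_univ_two]
  have e1 : (fun q => (S q).mulVec ![f q, 1] 1) = fun q => S q 1 0 * f q + S q 1 1 := by
    funext q
    simp [Matrix.mulVec, dotProduct, Fin.sum_univ_two]
  simp only [Pi.sub_apply, dVec, Matrix.cons_val_zero, Matrix.cons_val_one, e0, e1,
    dd_const] at h
  rw [dd_mul hf.smooth sl] at h
  have hr := hf.right p (coordVec p)
  have hne := hf.dd_coordVec_ne_zero p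
  apply mul_left_cancel₀ hne
  linear_combination (norm := noncomm_ring) hr - h

/-- Identify `ℍ²/L` with `ℍ` by `v ↦ v₀ - f v₁`. Then `*δ = S δ` on `(f, 1)` reads `*df = (S₀₀ - f
S₁₀) df`. -/
theorem left_eq (hS : IsMeanCurvatureSphere f S) (hf : IsConformalImmersion f N R) (p : M) :
    N p = S p 0 0 - f p * S p 1 0 := by
  have h := mem_line_iff.1
    (hS.star_delta_eq_S_delta _ (isSection_base hf.smooth) p (coordVec p))
  simp only [Pi.sub_apply, dVec, Matrix.cons_val_zero, Matrix.cons_val_one, dd_const,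
    Matrix.mulVec, dotProduct, Fin.sum_univ_two, mul_zero, add_zero, zero_sub] at h
  have hl := hf.left p (coordVec p)
  apply mul_right_cancel₀ (hf.dd_coordVec_ne_zero p)
  linear_combination (norm := noncomm_ring) -hl + h

theorem smooth_right (hS : IsMeanCurvatureSphere f S) (hf : IsConformalImmersion f N R) :
    SmoothFun R := by
  rw [funext (hS.right_eq hf)]
  exact (((hS.smooth 1 0).mul hf.smooth).add (hS.smooth 1 1)).neg

theorem smooth_left (hS : IsMeanCurvatureSphere f S) (hf : IsConformalImmersion f N R) :
    SmoothFun N := by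
  rw [funext (hS.left_eq hf)]
  exact (hS.smooth 0 0).sub (hf.smooth.mul (hS.smooth 1 0))

/-- The lower left entry `-H` of `S` satisfies `H N = R H`. -/
theorem entry_mul_left (hS : IsMeanCurvatureSphere f S) (hf : IsConformalImmersion f N R)
    (p : M) : S p 1 0 * N p = R p * S p 1 0 := by
  have h := congrFun (congrFun (hS.sq p) 1) 0
  simp only [Matrix.mul_apply, Fin.sum_univ_two, Matrix.neg_apply, Matrix.one_apply,
    one_ne_zero, if_false, neg_zero] at h
  rw [hS.right_eq hf p, hS.left_eq hf p]
  linear_combination (norm := noncomm_ring) h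

/-- Together with `dd_left'` this describes `dS` modulo `L` as the row `(dN + df S₁₀)(1, -f)`, which
kills `(f, 1)`. -/
theorem dd_left (hS : IsMeanCurvatureSphere f S) (hf : IsConformalImmersion f N R) (p : M)
    (X : Tang p) :
    dEnd S p X 0 0 - f p * dEnd S p X 1 0 = dd N p X + dd f p X * S p 1 0 := by
  have e := dd_sub (hS.smooth 0 0) (hf.smooth.mul (hS.smooth 1 0)) p X
  rw [dd_mul hf.smooth (hS.smooth 1 0), ← funext (hS.left_eq hf)] at e
  rw [e]
  simp only [dEnd, Matrix.of_apply]
  noncomm_ring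

theorem dd_left' (hS : IsMeanCurvatureSphere f S) (hf : IsConformalImmersion f N R) (p : M)
    (X : Tang p) :
    dEnd S p X 0 1 - f p * dEnd S p X 1 1 = -((dd N p X + dd f p X * S p 1 0) * f p) := by
  have hN := hS.smooth_left hf
  have h01 : (fun q => S q 0 1) = fun q => f q * S q 1 1 - N q * f q := by
    funext q
    rw [hS.left_eq hf q]
    linear_combination (norm := noncomm_ring) hS.line_eq q
  have e := dd_sub (hf.smooth.mul (hS.smooth 1 1)) (hN.mul hf.smooth) p X
  rw [dd_mul hf.smooth (hS.smooth 1 1), dd_mul hN hf.smooth, ← h01] at e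
  have hl := hf.left p X
  have hr := hf.right p X
  have hR := hS.right_eq hf p
  simp only [dEnd, Matrix.of_apply]
  rw [e]
  linear_combination (norm := noncomm_ring) hl - hr + dd f p X * hR

theorem dd_right (hS : IsMeanCurvatureSphere f S) (hf : IsConformalImmersion f N R) (p : M)
    (X : Tang p) :
    dEnd S p X 1 0 * f p + dEnd S p X 1 1 = -dd R p X - S p 1 0 * dd f p X := by
  have s1 := (hS.smooth 1 0).mul hf.smooth
  have e := dd_neg (s1.add (hS.smooth 1 1)) p X
  rw [dd_add s1 (hS.smooth 1 1), dd_mul (hS.smooth 1 0) hf.smooth,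
    ← funext (hS.right_eq hf)] at e
  rw [e]
  simp only [dEnd, Matrix.of_apply]
  noncomm_ring

theorem dEnd_base (hS : IsMeanCurvatureSphere f S) (hf : IsConformalImmersion f N R) (p : M)
    (X : Tang p) :
    dEnd S p X 0 0 * f p + dEnd S p X 0 1 = f p * (-dd R p X - S p 1 0 * dd f p X) := by
  rw [← hS.dd_right hf]
  linear_combination (norm := noncomm_ring) hS.dd_left hf p X * f p + hS.dd_left' hf p X

/-- The condition `Q|_L = 0` in terms of `R` and `H = -S₁₀`. -/
theorem right_form_add (hS : IsMeanCurvatureSphere f S) (hf : IsConformalImmersion f N R)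
    (p : M) (X : Tang p) :
    R p * dd R p X + dd R p (J p X) = -(2 * (S p 1 0 * N p * dd f p X)) := by
  have h := congrFun (hS.Q_line p X _ (base_mem_line p)) 1
  simp only [hopfQ, Matrix.smul_mulVec, Pi.smul_apply, Pi.zero_apply] at h
  have h' := (smul_eq_zero.1 h).resolve_left (by norm_num)
  simp only [Matrix.mulVec, dotProduct, Fin.sum_univ_two, Matrix.sub_apply, Matrix.mul_apply,
    Matrix.cons_val_zero, Matrix.cons_val_one, mul_one] at h'
  have b := hS.dEnd_base hf p X
  have d := hS.dd_right hf p X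
  have d' := hS.dd_right hf p (J p X)
  rw [hf.left] at d'
  have hR := hS.right_eq hf p
  have hHN := hS.entry_mul_left hf p
  linear_combination (norm := noncomm_ring) h' - S p 1 0 * b - S p 1 1 * d + d'
    - hR * (-dd R p X - S p 1 0 * dd f p X) + hHN * dd f p X

theorem hopfA_base (hS : IsMeanCurvatureSphere f S) (hf : IsConformalImmersion f N R)
    (p : M) (X : Tang p) :
    hopfA S p X 1 0 * f p + hopfA S p X 1 1
      = (1 / 4 : ℝ) • (R p * dd R p X - dd R p (J p X)) := by
  simp only [hopfA, Matrix.smul_apply, smul_mul_assoc, ← smul_add]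
  congr 1
  simp only [Fin.sum_univ_two, Matrix.add_apply, Matrix.mul_apply]
  have b := hS.dEnd_base hf p X
  have d := hS.dd_right hf p X
  have d' := hS.dd_right hf p (J p X)
  rw [hf.left] at d'
  have hR := hS.right_eq hf p
  have hHN := hS.entry_mul_left hf p
  linear_combination (norm := noncomm_ring) S p 1 0 * b + S p 1 1 * d + d'
    + hR * (-dd R p X - S p 1 0 * dd f p X) - hHN * dd f p X

variable [IsManifold 𝓘(ℂ, ℂ) ω M]

/-- The condition `im A ⊂ L` in terms of `N` and `H = -S₁₀`. -/
theorem left_form_add (hS : IsMeanCurvatureSphere f S) (hf : IsConformalImmersion f N R)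
    (p : M) (X : Tang p) :
    N p * dd N p X + dd N p (J p X) + 2 * (N p * dd f p X * S p 1 0) = 0 := by
  have hN := hS.smooth_left hf
  have hR := hS.smooth_right hf
  have hloc := hf.isConformalParam hN hR p
  have hn := hf.N_sq p
  have one : N p * dd N p (coordVec p) + dd N p (J p (coordVec p))
      -- On `∂/∂x`, `left_right_relation` turns `right_form_add` into the statement for `N`, after
      -- cancelling `df`. Left multiplication by `N` then gives `J ∂/∂x`, and real linearity gives
      -- every `X`.
      + 2 * (N p * dd f p (coordVec p) * S p 1 0) = 0 := by
    have rel := hloc.left_right_relation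
    rw [localRep_self, localRep_self, ← dd_coordVec hN, ← dd_J_coordVec hN,
      ← dd_coordVec hf.smooth, ← dd_coordVec hR, ← dd_J_coordVec hR] at rel
    have q := hS.right_form_add hf p (coordVec p)
    have hHN := hS.entry_mul_left hf p
    have hna : N p * dd f p (coordVec p) = -(dd f p (coordVec p) * R p) := by
      rw [← hf.left, hf.right]
    apply mul_right_cancel₀ (hf.dd_coordVec_ne_zero p)
    linear_combination (norm := noncomm_ring) rel - dd f p (coordVec p) * q
      + 2 * hna * S p 1 0 * dd f p (coordVec p)
      + 2 * dd f p (coordVec p) * hHN * dd f p (coordVec p)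
  obtain ⟨s, t, rfl⟩ := exists_eq_coordVec p X
  simp only [map_add, map_smul, J_J, map_neg, hf.left]
  generalize coordVec p = e at *
  have two : ∀ x : ℍ[ℝ], 2 * x = (2 : ℝ) • x := fun x => by rw [two_mul, two_smul]
  have e2 : N p * dd N p (J p e) - dd N p e + 2 * (N p * (N p * dd f p e) * S p 1 0) = 0 := by
    linear_combination (norm := noncomm_ring) N p * one - hn * dd N p e
  calc _ = s • (N p * dd N p e + dd N p (J p e) + 2 * (N p * dd f p e * S p 1 0))
      + t • (N p * dd N p (J p e) - dd N p e + 2 * (N p * (N p * dd f p e) * S p 1 0)) := by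
        simp only [mul_add, add_mul, mul_smul_comm, smul_mul_assoc, two]
        module
    _ = 0 := by rw [one, e2, smul_zero, smul_zero, add_zero]

/-- Modulo `L`, `4A` is the left side of `left_form_add` times the row `(1, -f)`, so it vanishes. -/
theorem hopfA_range (hS : IsMeanCurvatureSphere f S) (hf : IsConformalImmersion f N R)
    (p : M) (X : Tang p) :
    hopfA S p X 0 0 = f p * hopfA S p X 1 0 ∧ hopfA S p X 0 1 = f p * hopfA S p X 1 1 := by
  have hl := hS.left_form_add hf p X
  have l0 := hS.dd_left hf p X
  have l1 := hS.dd_left' hf p X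
  have l0' := hS.dd_left hf p (J p X)
  have l1' := hS.dd_left' hf p (J p X)
  rw [hf.left] at l0' l1'
  have hN := hS.left_eq hf p
  have hL := hS.line_eq p
  constructor
  all_goals
    simp only [hopfA, Matrix.smul_apply, mul_smul_comm]
    congr 1
    simp only [Fin.sum_univ_two, Matrix.add_apply, Matrix.mul_apply]
  · linear_combination (norm := noncomm_ring) hl + N p * l0 + l0'
      - hN * (dEnd S p X 0 0 - f p * dEnd S p X 1 0) + hL * dEnd S p X 1 0
  · linear_combination (norm := noncomm_ring) -hl * f p + N p * l1 + l1'
      - hN * (dEnd S p X 0 1 - f p * dEnd S p X 1 1) + hL * dEnd S p X 1 1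

theorem willmoreIntegrand_eq (hS : IsMeanCurvatureSphere f S)
    (hf : IsConformalImmersion f N R) (p : M) (X : Tang p) :
    willmoreIntegrand S p X = (1 / 16) * ‖R p * dd R p X - dd R p (J p X)‖ ^ 2 := by
  have hr := hf.R_sq p
  have hloc := hf.isConformalParam (hS.smooth_left hf) (hS.smooth_right hf) p
  have anti : ∀ Y : Tang p, R p * dd R p Y + dd R p Y * R p = 0 := by
    intro Y
    have h := hloc.right_anticomm Y
    rwa [localRep_self, ← dd_apply (hS.smooth_right hf)] at h
  have hre : ∀ Y : Tang p, (hopfA S p Y 1 0 * f p + hopfA S p Y 1 1).re = 0 := by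
    intro Y
    rw [hS.hopfA_base hf, Quaternion.re_smul]
    have : (R p * dd R p Y - dd R p (J p Y)).re = 0 := by
      apply re_eq_zero_of_anticomm hr
      linear_combination (norm := noncomm_ring) R p * anti Y - anti (J p Y)
    rw [this, smul_zero]
  have sq : ∀ Y : Tang p, avg (hopfA S p Y * hopfA S p Y)
      = -((1 / 32) * ‖R p * dd R p Y - dd R p (J p Y)‖ ^ 2) := by
    intro Y
    obtain ⟨h0, h1⟩ := hS.hopfA_range hf p Y
    rw [avg_sq_of_range h0 h1, re_mul_self_of_re_eq_zero (hre Y), hS.hopfA_base hf, norm_smul]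
    norm_num
    ring
  have hJ : ‖R p * dd R p (J p X) - dd R p (J p (J p X))‖
      = ‖R p * dd R p X - dd R p (J p X)‖ := by
    have e : R p * dd R p (J p X) - dd R p (J p (J p X))
        = -R p * (R p * dd R p X - dd R p (J p X)) := by
      rw [J_J, map_neg]
      linear_combination (norm := noncomm_ring) hr * dd R p X
    rw [e, norm_mul, norm_neg, norm_of_sq hr, one_mul]
  -- Since `J² = -1`, `(A ∧ *A)(X, JX) = -A(X)² - A(JX)²`; each term contributes `1/32` of the
  -- squared norm.
  rw [willmoreIntegrand, wedge, starForm, starForm, J_J, hopfA_neg, mul_neg, avg_sub, avg_neg,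
    sq, sq, hJ]
  ring

end IsMeanCurvatureSphere

/-- For a surface in `Im ℍ` the left and right normals agree. -/
theorem IsConformalImmersion.left_eq_right_of_re_eq_zero (hf : IsConformalImmersion f N R)
    (him : ∀ q, (f q).re = 0) : N = R := by
  funext p
  have hre : ∀ X : Tang p, (dd f p X).re = 0 := by
    intro X
    have hzero : (fun z => inner ℝ (1 : ℍ[ℝ]) (localRep f p z)) = fun _ => 0 := by
      funext z
      rw [inner_eq_components, localRep, him]
      simp
    have key : ∀ v : ℂ, (fderiv ℝ (localRep f p) (chartAt ℂ p p) v).re = 0 := by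
      intro v
      have e := fderiv_inner_apply ℝ (differentiableAt_const (1 : ℍ[ℝ]))
        (differentiableAt_localRep hf.smooth p) v
      rw [hzero, inner_eq_components] at e
      simpa using e.symm
    rw [dd_apply hf.smooth]
    exact key X
  have h := hf.left p (coordVec p)
  rw [hf.right] at h
  have hn := re_eq_zero_of_sq (hf.N_sq p)
  have hr := re_eq_zero_of_sq (hf.R_sq p)
  have h1 := hre (coordVec p)
  have h2 := hre (J p (coordVec p))
  rw [hf.left] at h2
  -- With `a = df(∂/∂x)`, the quaternions `N`, `a` and `N a` are all imaginary, so conjugating `N a`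
  -- gives `a N = -N a = a R`.
  have hna : star (N p * dd f p (coordVec p)) = -(N p * dd f p (coordVec p)) :=
    Quaternion.star_eq_neg.2 h2
  rw [star_mul, Quaternion.star_eq_neg.2 h1, Quaternion.star_eq_neg.2 hn, neg_mul_neg, ← h,
    neg_neg] at hna
  exact mul_left_cancel₀ (hf.dd_coordVec_ne_zero p) hna

end Sphere

end Willmore

theorem mainTheorem10 {M : Type*} [TopologicalSpace M] [ChartedSpace ℂ M]
    [IsManifold 𝓘(ℂ, ℂ) ω M] (f N R : M → ℍ[ℝ]) (hf : Willmore.IsConformalImmersion f N R)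
    (S : M → Willmore.EndHH) (hS : Willmore.IsMeanCurvatureSphere f S) :
    (∀ (p : M) (X : Willmore.Tang p),
      Willmore.willmoreIntegrand S p X =
        (1 / 16) * ‖R p * Willmore.dd R p X - Willmore.dd R p (Willmore.J p X)‖ ^ 2) ∧
    (∀ (p : M) (X U : Willmore.Tang p) (ξ : ℍ[ℝ]),
      Willmore.IsUnitTangent f p U → Willmore.IsUnitNormal f p ξ →
      (1 / 16) * ‖R p * Willmore.dd R p X - Willmore.dd R p (Willmore.J p X)‖ ^ 2 =
        (1 / 4) * (‖Willmore.meanCurvatureVector f p‖ ^ 2 - Willmore.gaussCurvature f p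
          - Willmore.normalCurvature f N p U ξ) * ‖Willmore.dd f p X‖ ^ 2) ∧
    ((∀ q, (f q).re = 0) → ∀ (p : M) (X : Willmore.Tang p),
      Willmore.willmoreIntegrand S p X =
        (1 / 4) * (‖Willmore.meanCurvatureVector f p‖ ^ 2 - Willmore.gaussCurvature f p)
          * ‖Willmore.dd f p X‖ ^ 2) := by
  have hN := hS.smooth_left hf
  have hR := hS.smooth_right hf
  refine ⟨hS.willmoreIntegrand_eq hf, ?_, ?_⟩
  · intro p X U ξ hU hξ
    have hloc := hf.isConformalParam hN hR p
    rw [Willmore.IsUnitTangent, Willmore.dd_apply hf.smooth] at hU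
    have hξ' : ∀ v : ℂ, inner ℝ (fderiv ℝ (Willmore.localRep f p) (chartAt ℂ p p) v) ξ = 0 := by
      exact fun v =>
        (congrArg (fun y => inner ℝ y ξ) (Willmore.dd_apply hf.smooth p v).symm).trans (hξ.2 v)
    have h := hloc.right_form_eq_curvature X hU hξ.1 hξ'
    rw [Willmore.localRep_self, Willmore.localRep_self] at h
    rw [Willmore.dd_apply hR, Willmore.dd_apply hR, Willmore.dd_apply hf.smooth]
    exact h
  · intro him p X
    obtain rfl := hf.left_eq_right_of_re_eq_zero him
    have h := (hf.isConformalParam hN hR p).right_form_eq_of_normals_eq X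
    rw [Willmore.localRep_self] at h
    rw [hS.willmoreIntegrand_eq hf, Willmore.dd_apply hR, Willmore.dd_apply hR,
      Willmore.dd_apply hf.smooth]
    exact h
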